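/- Let $(E,|\cdot|)$ be a real Banach space, $\ell\in\mathbb N$, and $2\le p<\gamma<[p]+1$. For a non-integer $a>1$, a map $W$ on $E$ is called $a$-Lipschitz if it is $C^{[a]}$, $W$ and its derivatives $W^{(r)}$, $r\le[a]$, are bounded, and $W^{([a])}$ is $(a-[a])$-Hölder; $\|W\|_a$ is the sum of $\sup_x|W^{(r)}(x)|$, $0\le r\le [a]$, and of the $(a-[a])$-Hölder seminorm of $W^{([a])}$. Let $V$ be a bounded Lipschitz vector field on $E$ and $V_1,\dots,V_\ell$ be $(\gamma-1)$-Lipschitz vector fields on $E$. Vector fields act on functions by $(Vf)(x)=D_xf(V(x))$; for $I=(i_1,\dots,i_r)\in\{1,\dots,\ell\}^r$ put $|I|=r$, $V_If=V_{i_1}(V_{i_2}(\cdots V_{i_r}f))$ and $V_{[I]}=[V_{i_1},[V_{i_2},\dots[V_{i_{r-1}},V_{i_r}]\dots]]$. Assume (C) every vector field $V_{[I]}$ with $1\le |I|\le[\gamma]$ maps any ball of $E$ into a compact set. Let $T>0$ and let ${\bf X}$ be a Hölder weak geometric $p$-rough path on $[0,T]$: a path in the truncated tensor algebra $\bigoplus_{r=0}^{[p]}(\mathbb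 R^\ell)^{\otimes r}$, with scalar part $1$, whose increments ${\bf X}_{ts}={\bf X}_s^{-1}{\bf X}_t=1\oplus X^1_{ts}\oplus\cdots\oplus X^{[p]}_{ts}$, $0\le s\le t\le T$, take values in the $[p]$-step free nilpotent group $\exp(\mathfrak g)$, where $\mathfrak g$ is the Lie subalgebra generated by $\mathbb R^\ell$, and such that $$\|{\bf X}\|=\max_{1\le i\le [p]}\ \sup_{0\le s<t\le T}\frac{|X^i_{ts}|}{|t-s|^{i/p}}<\infty .$$ Write $X^I_{ts}$ for the coordinates of ${\bf X}_{ts}$ in the canonical basis $e_I=e_{i_1}\cdots e_{i_r}$, and let $\Lambda^I_{ts}$ be real numbers such that $\exp\big(\sum_{1\le|I|\le[p]}\Lambda^I_{ts}e_{[I]}\big)={\bf X}_{ts}$, where $e_{[I]}=[e_{i_1},[e_{i_2},\dots[e_{i_{r-1}},e_{i_r}]\dots]]$. Consider, for $0\le s\le t\le T$, the differential equation $$\dot y_u=(t-s)V(y_u)+\sum_{1\le|I|\le[p]}\Lambda^I_{ts}V_{[I]}(y_u),\qquad 0\le u\le 1. \qquad (*)$$ Then, for all $0\le s\le t\le T$,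 such numbers $\Lambda^I_{ts}$ exist and can be chosen so that $(*)$ has a solution on $[0,1]$ started from any $x\in E$. Moreover there is a positive constant $c$, depending only on $E,\ell,p,\gamma$ and on upper bounds for $\sup|V|$, the Lipschitz constant of $V$ and the norms $\|V_i\|_{\gamma-1}$, such that, whenever $\mu_{ts}:E\to E$ associates to each $x$ the value at time $1$ of an arbitrary solution of $(*)$ started from $x$ (for some choice of the $\Lambda^I_{ts}$ not depending on $x$), $$\Big\|f\circ\mu_{ts}-\Big\{f+(t-s)Vf+\sum_{1\le|I|\le[p]}X^I_{ts}V_If\Big\}\Big\|_\infty\le c\,(1+\|{\bf X}\|^\gamma)\,\|f\|_\gamma\,|t-s|^{\gamma/p}$$ for every $\gamma$-Lipschitz function $f:E\to\mathbb R$ and all $0\le s\le t\le T$. -/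

import Mathlib

open scoped NNReal ENNReal

/-! ### The truncated tensor algebra over `ℝ^ℓ` -/

/-- The truncated tensor algebra `⨁_{r ≤ N} (ℝ^ℓ)^{⊗ r}`, an element being given by its coordinates
in the canonical basis `e_{i₁} ⊗ ⋯ ⊗ e_{i_r}`, indexed by the words of length at most `N`. -/
def TruncTensor (ℓ N : ℕ) : Type := {w : List (Fin ℓ) // w.length ≤ N} → ℝ

namespace TruncTensor

variable {ℓ N : ℕ}

@[ext] theorem ext {a b : TruncTensor ℓ N} (h : ∀ w, a w = b w) : a = b := funext h

noncomputable instance : AddCommGroup (TruncTensor ℓ N) :=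
  inferInstanceAs (AddCommGroup ({w : List (Fin ℓ) // w.length ≤ N} → ℝ))

noncomputable instance : Module ℝ (TruncTensor ℓ N) :=
  inferInstanceAs (Module ℝ ({w : List (Fin ℓ) // w.length ≤ N} → ℝ))

@[simp] theorem add_apply (a b : TruncTensor ℓ N) (w) : (a + b) w = a w + b w := rfl
@[simp] theorem zero_apply (w) : (0 : TruncTensor ℓ N) w = 0 := rfl
@[simp] theorem smul_apply (c : ℝ) (a : TruncTensor ℓ N) (w) : (c • a) w = c * a w := rfl

/-- The coordinate `a^I` of `a` along the word `I` (zero if the word is longer than `N`). -/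
def coord (a : TruncTensor ℓ N) (w : List (Fin ℓ)) : ℝ :=
  if h : w.length ≤ N then a ⟨w, h⟩ else 0

theorem apply_eq_coord (a : TruncTensor ℓ N) (w : {w : List (Fin ℓ) // w.length ≤ N}) :
    a w = a.coord w.1 := by
  simp [coord, w.2]

theorem ext_coord {a b : TruncTensor ℓ N}
    (h : ∀ w : List (Fin ℓ), w.length ≤ N → a.coord w = b.coord w) : a = b := by
  ext ⟨w, hw⟩
  simpa [coord, hw] using h w hw

/-- The truncated tensor product: in degree `r` it is `∑_{k ≤ r} a_k ⊗ b_{r-k}`. -/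
noncomputable instance : Mul (TruncTensor ℓ N) where
  mul a b := fun w => ∑ k ∈ Finset.range (w.1.length + 1),
    a.coord (w.1.take k) * b.coord (w.1.drop k)

noncomputable instance : One (TruncTensor ℓ N) where
  one := fun w => if w.1 = [] then 1 else 0

theorem mul_apply (a b : TruncTensor ℓ N) (w) :
    (a * b) w = ∑ k ∈ Finset.range (w.1.length + 1),
      a.coord (w.1.take k) * b.coord (w.1.drop k) := rfl

theorem one_apply (w) : (1 : TruncTensor ℓ N) w = if w.1 = [] then 1 else 0 := rfl

theorem coord_mul (a b : TruncTensor ℓ N) {w : List (Fin ℓ)} (h : w.length ≤ N) :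
    (a * b).coord w = ∑ k ∈ Finset.range (w.length + 1),
      a.coord (w.take k) * b.coord (w.drop k) := by
  simp only [coord, h, dite_true]
  rfl

theorem coord_add (a b : TruncTensor ℓ N) (w : List (Fin ℓ)) :
    (a + b).coord w = a.coord w + b.coord w := by
  by_cases h : w.length ≤ N <;> simp [coord, h]

theorem coord_smul (c : ℝ) (a : TruncTensor ℓ N) (w : List (Fin ℓ)) :
    (c • a).coord w = c * a.coord w := by
  by_cases h : w.length ≤ N <;> simp [coord, h]

theorem coord_zero (w : List (Fin ℓ)) : (0 : TruncTensor ℓ N).coord w = 0 := by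
  by_cases h : w.length ≤ N <;> simp [coord, h]

theorem coord_one (w : List (Fin ℓ)) :
    (1 : TruncTensor ℓ N).coord w = if w = [] then 1 else 0 := by
  by_cases h : w.length ≤ N
  · simp [coord, h, one_apply]
  · have : w ≠ [] := by rintro rfl; simp at h
    simp [coord, h, this]

protected theorem mul_assoc (a b c : TruncTensor ℓ N) : a * b * c = a * (b * c) := by
  ext ⟨w, hw⟩
  simp only [mul_apply]
  have h1 : ∀ k ∈ Finset.range (w.length + 1),
      (a * b).coord (w.take k) * c.coord (w.drop k) =
      ∑ j ∈ Finset.range (k + 1), a.coord (w.take j) * b.coord ((w.drop j).take (k - j))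
        * c.coord (w.drop k) := by
    intro k hk
    have hk' : k ≤ w.length := by simpa [Nat.lt_succ_iff] using hk
    have hl : (w.take k).length = k := by simp [hk']
    rw [coord_mul _ _ (by omega), hl, Finset.sum_mul]
    refine Finset.sum_congr rfl fun j hj => ?_
    have hj' : j ≤ k := by simpa [Nat.lt_succ_iff] using hj
    rw [List.take_take, min_eq_left hj', List.drop_take]
  have h2 : ∀ j ∈ Finset.range (w.length + 1),
      a.coord (w.take j) * (b * c).coord (w.drop j) =
      ∑ i ∈ Finset.range (w.length - j + 1), a.coord (w.take j) * b.coord ((w.drop j).take i)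
        * c.coord (w.drop (j + i)) := by
    intro j hj
    have hl : (w.drop j).length = w.length - j := by simp
    rw [coord_mul _ _ (by omega), hl, Finset.mul_sum]
    refine Finset.sum_congr rfl fun i _ => ?_
    rw [List.drop_drop, mul_assoc]
  rw [Finset.sum_congr rfl h1, Finset.sum_congr rfl h2, Finset.sum_sigma', Finset.sum_sigma']
  refine Finset.sum_bij' (fun x _ => ⟨x.2, x.1 - x.2⟩) (fun x _ => ⟨x.1 + x.2, x.1⟩) ?_ ?_ ?_ ?_ ?_
  · rintro ⟨k, j⟩ h
    simp at h ⊢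
    omega
  · rintro ⟨k, j⟩ h
    simp at h ⊢
    omega
  · rintro ⟨k, j⟩ h
    simp at h
    have : j + (k - j) = k := by omega
    simp [this]
  · rintro ⟨k, j⟩ h
    simp
  · rintro ⟨k, j⟩ h
    simp at h
    have : j + (k - j) = k := by omega
    simp [this]

noncomputable instance : Ring (TruncTensor ℓ N) where
  __ := (inferInstance : AddCommGroup (TruncTensor ℓ N))
  mul_assoc := TruncTensor.mul_assoc
  left_distrib a b c := by
    ext w
    simp [mul_apply, coord_add, mul_add, Finset.sum_add_distrib]
  right_distrib a b c := by
    ext w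
    simp [mul_apply, coord_add, add_mul, Finset.sum_add_distrib]
  zero_mul a := by
    ext w
    simp [mul_apply, coord_zero]
  mul_zero a := by
    ext w
    simp [mul_apply, coord_zero]
  one_mul a := by
    ext ⟨w, hw⟩
    rw [mul_apply, Finset.sum_eq_single 0]
    · simp [coord_one, apply_eq_coord]
    · intro k hk hk0
      have : w.take k ≠ [] := by
        simp only [Finset.mem_range] at hk
        simp only [ne_eq, List.take_eq_nil_iff, not_or]
        refine ⟨hk0, ?_⟩
        rintro rfl
        simp at hk
        omega
      simp [coord_one, this]
    · simp
  mul_one a := by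
    ext ⟨w, hw⟩
    rw [mul_apply, Finset.sum_eq_single w.length]
    · simp [coord_one, apply_eq_coord]
    · intro k hk hk0
      have : w.drop k ≠ [] := by
        simp only [Finset.mem_range] at hk
        simp only [ne_eq, List.drop_eq_nil_iff]
        omega
      simp [coord_one, this]
    · simp

noncomputable instance : Algebra ℝ (TruncTensor ℓ N) :=
  Algebra.ofModule
    (fun r x y => by
      ext w
      simp [mul_apply, coord_smul, Finset.mul_sum, mul_assoc])
    (fun r x y => by
      ext w
      simp [mul_apply, coord_smul, Finset.mul_sum, mul_left_comm])

/-- The Lie bracket `[a, b] = a b - b a`. -/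
noncomputable instance : LieRing (TruncTensor ℓ N) := LieRing.ofAssociativeRing

noncomputable instance : LieAlgebra ℝ (TruncTensor ℓ N) := LieAlgebra.ofAssociativeAlgebra

/-- The canonical basis vector `e_i` of `ℝ^ℓ`, seen in the truncated tensor algebra. -/
def letter (N : ℕ) {ℓ : ℕ} (i : Fin ℓ) : TruncTensor ℓ N := fun w => if w.1 = [i] then 1 else 0

/-- The iterated bracket `e_{[I]} = [e_{i₁}, [e_{i₂}, … [e_{i_{r-1}}, e_{i_r}] … ]]`. -/
noncomputable def bracketWord (N : ℕ) {ℓ : ℕ} : List (Fin ℓ) → TruncTensor ℓ N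
  | [] => 0
  | [i] => letter N i
  | i :: j :: I => ⁅letter N i, bracketWord N (j :: I)⁆

/-- The exponential series; for an element without scalar part, its powers of order `> N` vanish,
so that this finite sum is the whole series. -/
noncomputable def texp (a : TruncTensor ℓ N) : TruncTensor ℓ N :=
  ∑ n ∈ Finset.range (N + 1), ((n.factorial : ℝ)⁻¹) • a ^ n

/-- The `N`-step free nilpotent Lie algebra: the Lie subalgebra (for the commutator) generated
by `ℝ^ℓ`. -/
noncomputable def freeNilpotentLie (ℓ N : ℕ) : LieSubalgebra ℝ (TruncTensor ℓ N) :=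
  LieSubalgebra.lieSpan ℝ (TruncTensor ℓ N) (Set.range (letter N))

/-- The `N`-step free nilpotent group `exp 𝔤`. -/
def freeNilpotentGroup (ℓ N : ℕ) : Set (TruncTensor ℓ N) :=
  texp '' (freeNilpotentLie ℓ N : Set (TruncTensor ℓ N))

/-- The Euclidean norm of the component of degree `r`. -/
noncomputable def levelNorm (r : ℕ) (a : TruncTensor ℓ N) : ℝ :=
  Real.sqrt (∑ I : Fin r → Fin ℓ, a.coord (List.ofFn I) ^ 2)

end TruncTensor

open TruncTensor

/-! ### Rough paths -/

section RoughPath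

variable {ℓ N : ℕ}

/-- The increment `𝐗_{ts} = 𝐗_s⁻¹ 𝐗_t`. -/
noncomputable def roughIncrement (X : ℝ → TruncTensor ℓ N) (s t : ℝ) : TruncTensor ℓ N :=
  Ring.inverse (X s) * X t

/-- The quotients `|X^i_{ts}| / |t - s|^{i/p}`, for `1 ≤ i ≤ [p]` and `0 ≤ s < t ≤ T`. -/
def holderRatios (p T : ℝ) (X : ℝ → TruncTensor ℓ ⌊p⌋₊) : Set ℝ :=
  {q | ∃ i : ℕ, ∃ s t : ℝ, 1 ≤ i ∧ i ≤ ⌊p⌋₊ ∧ 0 ≤ s ∧ s < t ∧ t ≤ T ∧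
    q = levelNorm i (roughIncrement X s t) / |t - s| ^ ((i : ℝ) / p)}

/-- The norm `‖𝐗‖ = max_{i} sup_{s<t} |X^i_{ts}| / |t - s|^{i/p}` of a rough path. -/
noncomputable def roughNorm (p T : ℝ) (X : ℝ → TruncTensor ℓ ⌊p⌋₊) : ℝ :=
  sSup (holderRatios p T X)

/-- Hölder weak geometric `p`-rough paths on `[0,T]`: paths in the truncated tensor algebra with
scalar part `1`, with finite Hölder norm, whose increments belong to the free nilpotent group. -/
structure IsWeakGeometricRoughPath (p T : ℝ) (X : ℝ → TruncTensor ℓ ⌊p⌋₊) : Prop where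
  scalar_part : ∀ t, 0 ≤ t → t ≤ T → (X t).coord [] = 1
  holder : BddAbove (holderRatios p T X)
  geometric : ∀ s t, 0 ≤ s → s ≤ t → t ≤ T → roughIncrement X s t ∈ freeNilpotentGroup ℓ ⌊p⌋₊

end RoughPath

/-! ### Functions and vector fields on a Banach space -/

section Fields

variable {E F : Type*} [NormedAddCommGroup E] [NormedSpace ℝ E]
  [NormedAddCommGroup F] [NormedSpace ℝ F]

/-- The norm `‖W‖_γ`: the sum of the sup norms of the derivatives of order `0, …, [γ]` and of the
`{γ}`-Hölder seminorm of the derivative of order `[γ]` (possibly infinite). -/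
noncomputable def eGammaNorm (γ : ℝ) (W : E → F) : ℝ≥0∞ :=
  (∑ r ∈ Finset.range (⌊γ⌋₊ + 1), ⨆ x, ‖iteratedFDeriv ℝ r W x‖ₑ) +
    eHolderNorm (Real.toNNReal (Int.fract γ)) (iteratedFDeriv ℝ ⌊γ⌋₊ W)

/-- `γ`-Lipschitz maps (`γ > 1` not an integer). -/
def IsGammaLipschitz (γ : ℝ) (W : E → F) : Prop :=
  ContDiff ℝ (⌊γ⌋₊ : ℕ) W ∧ eGammaNorm γ W < ⊤

/-- The real number `‖W‖_γ`, for `W` a `γ`-Lipschitz map. -/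
noncomputable def gammaNorm (γ : ℝ) (W : E → F) : ℝ := (eGammaNorm γ W).toReal

/-- A vector field acting on functions: `(V f)(x) = D_x f (V x)`. -/
noncomputable def fieldDeriv (V : E → E) (f : E → ℝ) : E → ℝ := fun x => fderiv ℝ f x (V x)

/-- The differential operator `V_I f = V_{i₁}(V_{i₂}(⋯ V_{i_r} f))`. -/
noncomputable def wordDeriv {ℓ : ℕ} (W : Fin ℓ → E → E) : List (Fin ℓ) → (E → ℝ) → E → ℝ
  | [], f => f
  | i :: I, f => fieldDeriv (W i) (wordDeriv W I f)

/-- The iterated bracket `V_{[I]} = [V_{i₁}, [V_{i₂}, … [V_{i_{r-1}}, V_{i_r}] … ]]`, where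
`[V, W] = DW·V - DV·W`. -/
noncomputable def bracketField {ℓ : ℕ} (W : Fin ℓ → E → E) : List (Fin ℓ) → E → E
  | [] => 0
  | [i] => W i
  | i :: j :: I => VectorField.lieBracket ℝ (W i) (bracketField W (j :: I))

/-- The compactness assumption (C): every `V_{[I]}` with `1 ≤ |I| ≤ n` maps every ball into a
compact set. -/
def MapsBallsIntoCompacts {ℓ : ℕ} (n : ℕ) (W : Fin ℓ → E → E) : Prop :=
  ∀ I : List (Fin ℓ), 1 ≤ I.length → I.length ≤ n → ∀ (y₀ : E) (R : ℝ),
    ∃ C : Set E, IsCompact C ∧ Set.MapsTo (bracketField W I) (Metric.closedBall y₀ R) C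

/-- `Λ` is a family of coordinates of the logarithm of `a` along the brackets `e_{[I]}`:
`exp (∑_{1 ≤ |I| ≤ N} Λ^I e_{[I]}) = a`. -/
def IsLogCoordinates {ℓ N : ℕ} (a : TruncTensor ℓ N) (Λ : List (Fin ℓ) → ℝ) : Prop :=
  texp (∑ r ∈ Finset.Icc 1 N, ∑ I : Fin r → Fin ℓ,
    Λ (List.ofFn I) • bracketWord N (List.ofFn I)) = a

/-- The vector field `h V + ∑_{1 ≤ |I| ≤ N} Λ^I V_{[I]}`. -/
noncomputable def logODEField {ℓ : ℕ} (N : ℕ) (V : E → E) (W : Fin ℓ → E → E) (h : ℝ)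
    (Λ : List (Fin ℓ) → ℝ) (x : E) : E :=
  h • V x + ∑ r ∈ Finset.Icc 1 N, ∑ I : Fin r → Fin ℓ,
    Λ (List.ofFn I) • bracketField W (List.ofFn I) x

/-- `m` is a time `1` map `μ_{ts}` of the log-ODE: `m x` is the value at time `1` of some solution,
on `[0,1]`, started from `x`, of `y' = (t - s) V(y) + ∑ Λ^I_{ts} V_{[I]}(y)`. -/
def IsLogODEMap {ℓ N : ℕ} (V : E → E) (W : Fin ℓ → E → E) (X : ℝ → TruncTensor ℓ N)
    (s t : ℝ) (m : E → E) : Prop :=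
  ∃ Λ : List (Fin ℓ) → ℝ, IsLogCoordinates (roughIncrement X s t) Λ ∧
    ∀ x, ∃ y : ℝ → E, y 0 = x ∧ y 1 = m x ∧ ∀ u ∈ Set.Icc (0 : ℝ) 1,
      HasDerivWithinAt y (logODEField N V W (t - s) Λ (y u)) (Set.Icc 0 1) u

end Fields

/-! Write `N = ⌊p⌋₊ = ⌊γ⌋₊`, `α = γ - N`, `h = t - s`, and let `L` be the logarithm of the
increment. Sending the letter `e_i` to the operator `V_i` turns tensor products into compositions
and brackets into Lie brackets of fields. Hence the degree `k` part of the log-ODE field acts on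
functions as `∑_{|w| = k} L^w V_w` (`fderiv_apply_bracketField`, `fderiv_apply_levelField`). The
numbers `Λ^I` are not unique, but only `L` matters.

Along a solution `y`, the functions `φ_M(u) = V_M f(y_u)`, `|M| < N`, therefore satisfy the
triangular system `φ_M' = ∑_{|K| ≤ N - |M|} L^K φ_{KM} + r_M`, where `r_M` collects the drift `h V`
and the levels too high to be expanded. Pairing with `E(u) = exp((1 - u) L)`, for which `E' = -L E`,
cancels all linear terms except those ending on words `Q` of length `N`, which leave `φ_Q(u) -
φ_Q(0)` (`abs_sub_sum_coord_texp_le`). Integrating over `[0,1]` yields the expansion with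
coefficients `exp L`.

Put `ρ = (1 + ‖𝐗‖) h^{1/p}`. Coordinates of degree `k` of `L`, `E` and `L E` are `O(ρ^k)`
(`exists_homBound`). If `ρ ≤ 1`, the solution moves by `O(ρ)`, and the errors are `ρ^N ρ^α = ρ^γ`
from the Hölder continuity of `V_Q f`, `ρ^{N+1}` from the unexpanded levels, and `h ρ ≤ ρ^{p+1}`
from the drift once `h V f(x)` is subtracted; all are `O(ρ^γ)` because `γ ≤ N + 1 ≤ p + 1`
(`exists_taylor_const`). If `ρ ≥ 1`, every term is separately `O(ρ^γ)` (`exists_error_const`).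

Existence has two sources. The right-nested brackets span the free nilpotent Lie algebra, which
provides `Λ`. The brackets of length `N` are only known to be continuous, so the equation is solved
by a Peano theorem for a Lipschitz field plus a compact one
(`exists_hasDerivWithinAt_of_lipschitz_add_compact`); assumption (C) supplies the compactness. -/

/-! ### Words and the algebra of coordinates -/

section Words

variable {ℓ N : ℕ}

/-- The words of length `r` in `ℓ` letters. -/
noncomputable def words (ℓ r : ℕ) : Finset (List (Fin ℓ)) :=
  (List.finite_length_eq (Fin ℓ) r).toFinset

@[simp] theorem mem_words {r : ℕ} {w : List (Fin ℓ)} : w ∈ words ℓ r ↔ w.length = r := by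
  simp [words]

theorem sum_ofFn_eq_sum_words {M : Type*} [AddCommMonoid M] (r : ℕ) (f : List (Fin ℓ) → M) :
    ∑ I : Fin r → Fin ℓ, f (List.ofFn I) = ∑ w ∈ words ℓ r, f w := by
  refine Finset.sum_bij (fun I _ => List.ofFn I) (by simp) ?_ ?_ (by simp)
  · intro a _ b _ h
    exact List.ofFn_injective h
  · intro w hw
    rw [mem_words] at hw
    subst hw
    exact ⟨w.get, by simp, by simp⟩

theorem sum_words_zero {M : Type*} [AddCommMonoid M] (f : List (Fin ℓ) → M) :
    ∑ w ∈ words ℓ 0, f w = f [] := by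
  have : words ℓ 0 = {[]} := by ext w; simp
  rw [this, Finset.sum_singleton]

/-- Cutting the words of length `q` after `k` letters. -/
theorem sum_words_split {M : Type*} [AddCommMonoid M] {k q : ℕ} (hk : k ≤ q)
    (f : List (Fin ℓ) → List (Fin ℓ) → M) :
    ∑ w ∈ words ℓ q, f (w.take k) (w.drop k)
      = ∑ a ∈ words ℓ k, ∑ b ∈ words ℓ (q - k), f a b := by
  rw [← Finset.sum_product']
  refine Finset.sum_bij' (fun w _ => (w.take k, w.drop k)) (fun x _ => x.1 ++ x.2) ?_ ?_ ?_ ?_ ?_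
  · intro w hw
    simp only [mem_words, Finset.mem_product, List.length_take, List.length_drop] at hw ⊢
    omega
  · intro x hx
    simp only [mem_words, Finset.mem_product, List.length_append] at hx ⊢
    omega
  · intro w _
    simp
  · rintro ⟨a, b⟩ hx
    simp only [mem_words, Finset.mem_product] at hx
    simp [← hx.1]
  · intro w _
    rfl

/-- Cutting words is inverse to concatenating them, so the tensor product becomes a double sum over
pairs of words. Here `φ` is arbitrary; the case of interest is `φ w = V_w g x`. -/
theorem sum_coord_mul_smul {M : Type*} [AddCommGroup M] [Module ℝ M] (a b : TruncTensor ℓ N)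
    {q : ℕ} (hq : q ≤ N) (φ : List (Fin ℓ) → M) :
    ∑ w ∈ words ℓ q, (a * b).coord w • φ w
      = ∑ k ∈ Finset.range (q + 1), ∑ u ∈ words ℓ k, ∑ v ∈ words ℓ (q - k),
          (a.coord u * b.coord v) • φ (u ++ v) := by
  have h1 : ∀ w ∈ words ℓ q, (a * b).coord w • φ w = ∑ k ∈ Finset.range (q + 1),
      (a.coord (w.take k) * b.coord (w.drop k)) • φ (w.take k ++ w.drop k) := by
    intro w hw
    rw [mem_words] at hw
    rw [coord_mul _ _ (by omega), hw, Finset.sum_smul]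
    simp
  rw [Finset.sum_congr rfl h1, Finset.sum_comm]
  refine Finset.sum_congr rfl fun k hk => ?_
  exact sum_words_split (by simpa [Nat.lt_succ_iff] using hk)
    fun u v => (a.coord u * b.coord v) • φ (u ++ v)

theorem coord_sub (a b : TruncTensor ℓ N) (w : List (Fin ℓ)) :
    (a - b).coord w = a.coord w - b.coord w := by
  have := coord_add (a - b) b w
  rw [sub_add_cancel] at this
  linarith

theorem coord_sum {ι : Type*} (s : Finset ι) (f : ι → TruncTensor ℓ N) (w : List (Fin ℓ)) :
    (∑ i ∈ s, f i).coord w = ∑ i ∈ s, (f i).coord w := by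
  classical
  induction s using Finset.induction_on with
  | empty => simp [coord_zero]
  | insert a s ha ih => rw [Finset.sum_insert ha, Finset.sum_insert ha, coord_add, ih]

theorem coord_of_length_gt (a : TruncTensor ℓ N) {w : List (Fin ℓ)} (h : N < w.length) :
    a.coord w = 0 := by
  simp [coord, not_le.2 h]

theorem coord_letter (hN : 1 ≤ N) (i : Fin ℓ) (w : List (Fin ℓ)) :
    (letter N i).coord w = if w = [i] then 1 else 0 := by
  by_cases h : w.length ≤ N
  · simp [coord, h, letter]
  · rw [coord_of_length_gt _ (not_le.1 h), if_neg]
    rintro rfl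
    simp at h
    omega

theorem coord_letter_of_length_ne {i : Fin ℓ} {w : List (Fin ℓ)} (hw : w.length ≠ 1) :
    (letter N i).coord w = 0 := by
  have : w ≠ [i] := by rintro rfl; simp at hw
  by_cases h : w.length ≤ N
  · simp [coord, h, letter, this]
  · exact coord_of_length_gt _ (not_le.1 h)

theorem sum_coord_letter_mul {M : Type*} [AddCommGroup M] [Module ℝ M] (i : Fin ℓ)
    (b : TruncTensor ℓ N) {r : ℕ} (hr : r + 1 ≤ N) (φ : List (Fin ℓ) → M) :
    ∑ w ∈ words ℓ (r + 1), (letter N i * b).coord w • φ w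
      = ∑ v ∈ words ℓ r, b.coord v • φ (i :: v) := by
  rw [sum_coord_mul_smul _ _ hr, Finset.sum_eq_single 1, Finset.sum_eq_single [i]]
  · simp [coord_letter (by omega : 1 ≤ N)]
  · intro u _ hne
    simp [coord_letter (by omega : 1 ≤ N), hne]
  · simp
  · intro k _ hk
    refine Finset.sum_eq_zero fun u hu => Finset.sum_eq_zero fun v _ => ?_
    rw [mem_words] at hu
    rw [coord_letter_of_length_ne (by omega), zero_mul, zero_smul]
  · simp

theorem sum_coord_mul_letter {M : Type*} [AddCommGroup M] [Module ℝ M] (i : Fin ℓ)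
    (b : TruncTensor ℓ N) {r : ℕ} (hr : r + 1 ≤ N) (φ : List (Fin ℓ) → M) :
    ∑ w ∈ words ℓ (r + 1), (b * letter N i).coord w • φ w
      = ∑ v ∈ words ℓ r, b.coord v • φ (v ++ [i]) := by
  rw [sum_coord_mul_smul _ _ hr, Finset.sum_eq_single r]
  · refine Finset.sum_congr rfl fun u _ => ?_
    rw [Finset.sum_eq_single [i]]
    · simp [coord_letter (by omega : 1 ≤ N)]
    · intro v _ hne
      simp [coord_letter (by omega : 1 ≤ N), hne]
    · simp
  · intro k hk hne
    rw [Finset.mem_range] at hk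
    refine Finset.sum_eq_zero fun u hu => Finset.sum_eq_zero fun v hv => ?_
    rw [mem_words] at hv
    rw [coord_letter_of_length_ne (by omega), mul_zero, zero_smul]
  · simp

theorem coord_mul_of_length_ne {a b : TruncTensor ℓ N} {r s : ℕ}
    (ha : ∀ w, w.length ≠ r → a.coord w = 0) (hb : ∀ w, w.length ≠ s → b.coord w = 0)
    {w : List (Fin ℓ)} (hw : w.length ≠ r + s) : (a * b).coord w = 0 := by
  by_cases h : w.length ≤ N
  · rw [coord_mul _ _ h]
    refine Finset.sum_eq_zero fun k hk => ?_
    rw [Finset.mem_range] at hk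
    by_cases h1 : k = r
    · rw [hb _ (by rw [List.length_drop]; omega), mul_zero]
    · rw [ha _ (by rw [List.length_take]; omega), zero_mul]
  · exact coord_of_length_gt _ (not_le.1 h)

/-- `e_{[I]}` is homogeneous of degree `|I|`. -/
theorem coord_bracketWord_of_length_ne :
    ∀ (I w : List (Fin ℓ)), w.length ≠ I.length → (bracketWord N I).coord w = 0
  | [], w, _ => coord_zero w
  | [_], _, h => coord_letter_of_length_ne h
  | i :: j :: I, w, h => by
    have ih : ∀ v : List (Fin ℓ), v.length ≠ (j :: I).length →
        (bracketWord N (j :: I)).coord v = 0 := coord_bracketWord_of_length_ne (j :: I)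
    have hl : ∀ v : List (Fin ℓ), v.length ≠ 1 → (letter N i).coord v = 0 :=
      fun v hv => coord_letter_of_length_ne hv
    simp only [List.length_cons] at h ih
    rw [bracketWord, Ring.lie_def, coord_sub, coord_mul_of_length_ne hl ih (by omega),
      coord_mul_of_length_ne ih hl (by omega), sub_zero]

theorem coord_bracketWord_nil (I : List (Fin ℓ)) : (bracketWord N I).coord [] = 0 := by
  cases I with
  | nil => exact coord_zero _
  | cons i I => exact coord_bracketWord_of_length_ne _ _ (by simp)

theorem bracketWord_of_length_gt {I : List (Fin ℓ)} (h : N < I.length) :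
    bracketWord N I = 0 := by
  refine ext_coord fun w hw => ?_
  rw [coord_zero, coord_bracketWord_of_length_ne _ _ (by omega)]

/-- Pairing the bracket `[e_i, b]` with a function on words. -/
theorem sum_coord_lie_letter {M : Type*} [AddCommGroup M] [Module ℝ M] (i : Fin ℓ)
    (b : TruncTensor ℓ N) {r : ℕ} (hr : r + 1 ≤ N) (φ : List (Fin ℓ) → M) :
    ∑ w ∈ words ℓ (r + 1), (⁅letter N i, b⁆).coord w • φ w
      = ∑ v ∈ words ℓ r, b.coord v • φ (i :: v) - ∑ v ∈ words ℓ r, b.coord v • φ (v ++ [i]) := by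
  rw [← sum_coord_letter_mul i b hr, ← sum_coord_mul_letter i b hr, ← Finset.sum_sub_distrib]
  refine Finset.sum_congr rfl fun w _ => ?_
  rw [Ring.lie_def, coord_sub, sub_smul]

end Words

/-! ### The free nilpotent Lie algebra is spanned by the brackets `e_{[I]}` -/

section Span

variable {ℓ N : ℕ}

theorem lie_letter_bracketWord (i : Fin ℓ) {I : List (Fin ℓ)} (hI : I ≠ []) :
    ⁅letter N i, bracketWord N I⁆ = bracketWord N (i :: I) := by
  cases I with
  | nil => exact absurd rfl hI
  | cons j I => rfl

theorem lie_letter_mem_span (i : Fin ℓ) {b : TruncTensor ℓ N}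
    (hb : b ∈ Submodule.span ℝ (Set.range (bracketWord N (ℓ := ℓ)))) :
    ⁅letter N i, b⁆ ∈ Submodule.span ℝ (Set.range (bracketWord N (ℓ := ℓ))) := by
  induction hb using Submodule.span_induction with
  | mem x hx =>
    obtain ⟨I, rfl⟩ := hx
    rcases eq_or_ne I [] with rfl | hI
    · simp [bracketWord]
    · rw [lie_letter_bracketWord i hI]
      exact Submodule.subset_span ⟨_, rfl⟩
  | zero => simp
  | add x y _ _ hx hy => rw [lie_add]; exact add_mem hx hy
  | smul c x _ hx => rw [lie_smul]; exact Submodule.smul_mem _ _ hx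

/-- By the Jacobi identity, bracketing with `[e_i, e_{[J]}]` reduces to bracketings with `e_i` and
`e_{[J]}`. The recursion on the word needs all `b` at once, since it is also applied to `[e_i, b]`.
-/
theorem lie_bracketWord_mem_span {b : TruncTensor ℓ N} :
    ∀ (I : List (Fin ℓ)), b ∈ Submodule.span ℝ (Set.range (bracketWord N (ℓ := ℓ))) →
    ⁅bracketWord N I, b⁆ ∈ Submodule.span ℝ (Set.range (bracketWord N (ℓ := ℓ)))
  | [], _ => by simp [bracketWord]
  | [i], hb => lie_letter_mem_span i hb
  | i :: j :: I, hb => by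
    rw [bracketWord, lie_lie]
    exact sub_mem (lie_letter_mem_span i (lie_bracketWord_mem_span (j :: I) hb))
      (lie_bracketWord_mem_span (j :: I) (lie_letter_mem_span i hb))

theorem lie_mem_span_bracketWord {a b : TruncTensor ℓ N}
    (ha : a ∈ Submodule.span ℝ (Set.range (bracketWord N (ℓ := ℓ))))
    (hb : b ∈ Submodule.span ℝ (Set.range (bracketWord N (ℓ := ℓ)))) :
    ⁅a, b⁆ ∈ Submodule.span ℝ (Set.range (bracketWord N (ℓ := ℓ))) := by
  induction ha using Submodule.span_induction with
  | mem x hx =>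
    obtain ⟨I, rfl⟩ := hx
    exact lie_bracketWord_mem_span I hb
  | zero => simp
  | add x y _ _ hx hy => rw [add_lie]; exact add_mem hx hy
  | smul c x _ hx => rw [smul_lie]; exact Submodule.smul_mem _ _ hx

/-- The span of the right-nested brackets is closed under brackets and contains the letters, hence
contains the Lie subalgebra they generate. -/
theorem mem_span_of_mem_freeNilpotentLie {a : TruncTensor ℓ N} (ha : a ∈ freeNilpotentLie ℓ N) :
    a ∈ Submodule.span ℝ (Set.range (bracketWord N (ℓ := ℓ))) := by
  let S : LieSubalgebra ℝ (TruncTensor ℓ N) :=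
    { Submodule.span ℝ (Set.range (bracketWord N (ℓ := ℓ))) with
      lie_mem' := fun ha hb => lie_mem_span_bracketWord ha hb }
  have h : freeNilpotentLie ℓ N ≤ S := by
    refine LieSubalgebra.lieSpan_le.2 ?_
    rintro _ ⟨i, rfl⟩
    exact Submodule.subset_span ⟨[i], rfl⟩
  exact h ha

/-- The element `∑ Λ^I e_{[I]}` of the free nilpotent Lie algebra. -/
noncomputable def lieElement (N : ℕ) (Λ : List (Fin ℓ) → ℝ) : TruncTensor ℓ N :=
  ∑ r ∈ Finset.Icc 1 N, ∑ I ∈ words ℓ r, Λ I • bracketWord N I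

theorem isLogCoordinates_iff (a : TruncTensor ℓ N) (Λ : List (Fin ℓ) → ℝ) :
    IsLogCoordinates a Λ ↔ texp (lieElement N Λ) = a := by
  unfold IsLogCoordinates lieElement
  simp only [sum_ofFn_eq_sum_words _ fun I => Λ I • bracketWord N I]

theorem exists_lieElement_eq {a : TruncTensor ℓ N} (ha : a ∈ freeNilpotentLie ℓ N) :
    ∃ Λ : List (Fin ℓ) → ℝ, lieElement N Λ = a := by
  have h := mem_span_of_mem_freeNilpotentLie ha
  clear ha
  induction h using Submodule.span_induction with
  | mem x hx =>
    classical
    obtain ⟨I, rfl⟩ := hx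
    by_cases hI : 1 ≤ I.length ∧ I.length ≤ N
    · refine ⟨fun J => if J = I then 1 else 0, ?_⟩
      unfold lieElement
      rw [Finset.sum_eq_single I.length, Finset.sum_eq_single I]
      · simp
      · intro J _ hJ; simp [hJ]
      · simp
      · intro r _ hr
        refine Finset.sum_eq_zero fun J hJ => ?_
        rw [mem_words] at hJ
        have : J ≠ I := by rintro rfl; exact hr hJ.symm
        simp [this]
      · intro h; exact absurd (Finset.mem_Icc.2 hI) h
    -- The words outside the range of summation, empty or longer than `N`, have zero bracket.
    · refine ⟨fun _ => 0, ?_⟩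
      have h0 : bracketWord N I = 0 := by
        rcases eq_or_ne I [] with rfl | hne
        · rfl
        · have := List.length_pos_iff.2 hne
          exact bracketWord_of_length_gt (by omega)
      simp [lieElement, h0]
  | zero => exact ⟨fun _ => 0, by simp [lieElement]⟩
  | add x y _ _ hx hy =>
    obtain ⟨Λ, rfl⟩ := hx
    obtain ⟨Λ', rfl⟩ := hy
    exact ⟨fun I => Λ I + Λ' I, by simp [lieElement, add_smul, Finset.sum_add_distrib]⟩
  | smul c x _ hx =>
    obtain ⟨Λ, rfl⟩ := hx
    exact ⟨fun I => c * Λ I, by simp [lieElement, mul_smul, Finset.smul_sum]⟩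

theorem exists_isLogCoordinates {a : TruncTensor ℓ N} (ha : a ∈ freeNilpotentGroup ℓ N) :
    ∃ Λ : List (Fin ℓ) → ℝ, IsLogCoordinates a Λ := by
  obtain ⟨b, hb, rfl⟩ := ha
  obtain ⟨Λ, rfl⟩ := exists_lieElement_eq hb
  exact ⟨Λ, (isLogCoordinates_iff _ _).2 rfl⟩

theorem coord_lieElement_nil (Λ : List (Fin ℓ) → ℝ) : (lieElement N Λ).coord [] = 0 := by
  simp [lieElement, coord_sum, coord_smul, coord_bracketWord_nil]

theorem coord_lieElement (Λ : List (Fin ℓ) → ℝ) {k : ℕ} (hk1 : 1 ≤ k) (hkN : k ≤ N)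
    {w : List (Fin ℓ)} (hw : w.length = k) :
    (lieElement N Λ).coord w = ∑ I ∈ words ℓ k, Λ I * (bracketWord N I).coord w := by
  unfold lieElement
  rw [coord_sum, Finset.sum_eq_single k]
  · simp [coord_sum, coord_smul]
  · intro r _ hr
    rw [coord_sum]
    refine Finset.sum_eq_zero fun I hI => ?_
    rw [mem_words] at hI
    rw [coord_smul, coord_bracketWord_of_length_ne _ _ (by omega), mul_zero]
  · intro h
    exact absurd (Finset.mem_Icc.2 ⟨hk1, hkN⟩) h

end Span

/-! ### Nilpotency, units and the exponential -/

section Exponential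

variable {ℓ N : ℕ}

theorem coord_pow_of_length_lt {a : TruncTensor ℓ N} (ha : a.coord [] = 0) (n : ℕ)
    {w : List (Fin ℓ)} (hw : w.length < n) : (a ^ n).coord w = 0 := by
  induction n generalizing w with
  | zero => omega
  | succ n ih =>
    by_cases h : w.length ≤ N
    · rw [pow_succ', coord_mul _ _ h]
      refine Finset.sum_eq_zero fun k hk => ?_
      rcases Nat.eq_zero_or_pos k with rfl | hk0
      · simp [ha]
      · rw [Finset.mem_range] at hk
        rw [ih (by rw [List.length_drop]; omega), mul_zero]
    · exact coord_of_length_gt _ (not_le.1 h)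

theorem pow_succ_eq_zero_of_coord_nil {a : TruncTensor ℓ N} (ha : a.coord [] = 0) :
    a ^ (N + 1) = 0 :=
  ext_coord fun w hw => by rw [coord_pow_of_length_lt ha _ (by omega), coord_zero]

theorem isUnit_of_coord_nil {a : TruncTensor ℓ N} (ha : a.coord [] = 1) : IsUnit a := by
  have h : (1 - a).coord [] = 0 := by rw [coord_sub, coord_one, ha]; simp
  have := IsNilpotent.isUnit_one_sub ⟨N + 1, pow_succ_eq_zero_of_coord_nil h⟩
  rwa [sub_sub_cancel] at this

theorem coord_texp (a : TruncTensor ℓ N) (w : List (Fin ℓ)) :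
    (texp a).coord w = ∑ n ∈ Finset.range (N + 1), ((n.factorial : ℝ)⁻¹) * (a ^ n).coord w := by
  simp [texp, coord_sum, coord_smul]

theorem coord_texp_nil {a : TruncTensor ℓ N} (ha : a.coord [] = 0) : (texp a).coord [] = 1 := by
  rw [coord_texp, Finset.sum_eq_single 0]
  · simp [coord_one]
  · intro n _ hn
    rw [coord_pow_of_length_lt ha _ (by simpa using Nat.pos_of_ne_zero hn), mul_zero]
  · simp

theorem coord_texp_smul (a : TruncTensor ℓ N) (v : ℝ) (w : List (Fin ℓ)) :
    (texp (v • a)).coord w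
      = ∑ n ∈ Finset.range (N + 1), v ^ n * (((n.factorial : ℝ)⁻¹) * (a ^ n).coord w) := by
  rw [coord_texp]
  refine Finset.sum_congr rfl fun n _ => ?_
  rw [smul_pow, coord_smul]
  ring

/-- The truncation costs nothing: differentiating loses the term of order `N`, and in `a * texp (v •
a)` the corresponding extra term contains `a ^ (N + 1) = 0`. -/
theorem hasDerivAt_coord_texp_smul {a : TruncTensor ℓ N} (ha : a.coord [] = 0)
    (w : List (Fin ℓ)) (v : ℝ) :
    HasDerivAt (fun v : ℝ => (texp (v • a)).coord w) ((a * texp (v • a)).coord w) v := by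
  have h1 : (fun v : ℝ => (texp (v • a)).coord w) = fun v =>
      ∑ n ∈ Finset.range (N + 1), v ^ n * (((n.factorial : ℝ)⁻¹) * (a ^ n).coord w) :=
    funext fun v => coord_texp_smul a v w
  have h2 : HasDerivAt (fun v : ℝ =>
      ∑ n ∈ Finset.range (N + 1), v ^ n * (((n.factorial : ℝ)⁻¹) * (a ^ n).coord w))
      (∑ n ∈ Finset.range (N + 1),
        ((n : ℝ) * v ^ (n - 1)) * (((n.factorial : ℝ)⁻¹) * (a ^ n).coord w)) v := by
    refine HasDerivAt.fun_sum fun n _ => ?_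
    exact (hasDerivAt_pow n v).mul_const _
  rw [h1]
  convert h2 using 1
  rw [texp, Finset.mul_sum, coord_sum, Finset.sum_range_succ, Finset.sum_range_succ' _ N]
  simp only [smul_pow, mul_smul_comm, coord_smul, ← pow_succ', pow_succ_eq_zero_of_coord_nil ha,
    coord_zero, mul_zero, add_zero, Nat.cast_zero, zero_mul]
  refine Finset.sum_congr rfl fun n _ => ?_
  have : (n.factorial : ℝ) ≠ 0 := by positivity
  rw [Nat.factorial_succ, Nat.add_sub_cancel]
  push_cast
  field_simp

/-- Coordinates of degree at most `r` bounded by `C ρ^{|w|}`. -/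
def HomBound (r : ℕ) (C ρ : ℝ) (a : TruncTensor ℓ N) : Prop :=
  ∀ w : List (Fin ℓ), w.length ≤ r → |a.coord w| ≤ C * ρ ^ w.length

theorem HomBound.mul {r : ℕ} {C C' ρ : ℝ} (hC : 0 ≤ C) (hC' : 0 ≤ C') (hρ : 0 ≤ ρ)
    {a b : TruncTensor ℓ N} (ha : HomBound r C ρ a) (hb : HomBound r C' ρ b) :
    HomBound r ((N + 1) * C * C') ρ (a * b) := by
  intro w hw
  by_cases h : w.length ≤ N
  · rw [coord_mul _ _ h]
    have key : ∀ k ∈ Finset.range (w.length + 1),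
        |a.coord (w.take k) * b.coord (w.drop k)| ≤ C * C' * ρ ^ w.length := by
      intro k hk
      rw [Finset.mem_range] at hk
      have h1 := ha (w.take k) (by rw [List.length_take]; omega)
      have h2 := hb (w.drop k) (by rw [List.length_drop]; omega)
      have hl : ρ ^ w.length = ρ ^ (w.take k).length * ρ ^ (w.drop k).length := by
        rw [← pow_add, ← List.length_append, List.take_append_drop]
      rw [abs_mul, hl]
      calc _ ≤ (C * ρ ^ (w.take k).length) * (C' * ρ ^ (w.drop k).length) :=
            mul_le_mul h1 h2 (abs_nonneg _) (by positivity)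
        _ = _ := by ring
    calc _ ≤ ∑ k ∈ Finset.range (w.length + 1), C * C' * ρ ^ w.length :=
          (Finset.abs_sum_le_sum_abs _ _).trans (Finset.sum_le_sum key)
      _ = (w.length + 1) * (C * C' * ρ ^ w.length) := by simp
      _ ≤ (N + 1) * (C * C' * ρ ^ w.length) := by gcongr
      _ = _ := by ring
  · rw [coord_of_length_gt _ (not_le.1 h), abs_zero]
    positivity

/-- Without scalar parts, both factors of each nonzero term have smaller degree than the word. The
product is thus controlled one degree further than its factors, which drives the induction in
`exists_homBound_log`. -/
theorem HomBound.mul_succ {r : ℕ} {C C' ρ : ℝ} (hC : 0 ≤ C) (hC' : 0 ≤ C') (hρ : 0 ≤ ρ)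
    {a b : TruncTensor ℓ N} (ha : HomBound r C ρ a) (hb : HomBound r C' ρ b)
    (ha0 : a.coord [] = 0) (hb0 : b.coord [] = 0) :
    HomBound (r + 1) ((N + 1) * C * C') ρ (a * b) := by
  intro w hw
  by_cases h : w.length ≤ N
  · rw [coord_mul _ _ h]
    have key : ∀ k ∈ Finset.range (w.length + 1),
        |a.coord (w.take k) * b.coord (w.drop k)| ≤ C * C' * ρ ^ w.length := by
      intro k hk
      rw [Finset.mem_range] at hk
      rcases Nat.eq_zero_or_pos k with rfl | hk0
      · simp only [List.take_zero, ha0, zero_mul, abs_zero]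
        positivity
      rcases eq_or_ne k w.length with rfl | hkl
      · simp only [List.drop_length, hb0, mul_zero, abs_zero]
        positivity
      have h1 := ha (w.take k) (by rw [List.length_take]; omega)
      have h2 := hb (w.drop k) (by rw [List.length_drop]; omega)
      have hl : ρ ^ w.length = ρ ^ (w.take k).length * ρ ^ (w.drop k).length := by
        rw [← pow_add, ← List.length_append, List.take_append_drop]
      rw [abs_mul, hl]
      calc _ ≤ (C * ρ ^ (w.take k).length) * (C' * ρ ^ (w.drop k).length) :=
            mul_le_mul h1 h2 (abs_nonneg _) (by positivity)
        _ = _ := by ring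
    calc _ ≤ ∑ k ∈ Finset.range (w.length + 1), C * C' * ρ ^ w.length :=
          (Finset.abs_sum_le_sum_abs _ _).trans (Finset.sum_le_sum key)
      _ = (w.length + 1) * (C * C' * ρ ^ w.length) := by simp
      _ ≤ (N + 1) * (C * C' * ρ ^ w.length) := by gcongr
      _ = _ := by ring
  · rw [coord_of_length_gt _ (not_le.1 h), abs_zero]
    positivity

theorem HomBound.one {r : ℕ} {ρ : ℝ} (hρ : 0 ≤ ρ) : HomBound r 1 ρ (1 : TruncTensor ℓ N) := by
  intro w _
  rw [coord_one]
  split_ifs with h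
  · simp [h]
  · rw [abs_zero]; positivity

theorem HomBound.pow {r : ℕ} {C ρ : ℝ} (hC : 0 ≤ C) (hρ : 0 ≤ ρ) {a : TruncTensor ℓ N}
    (ha : HomBound r C ρ a) (n : ℕ) : HomBound r (((N + 1) * C) ^ n) ρ (a ^ n) := by
  induction n with
  | zero => simpa using HomBound.one hρ
  | succ n ih =>
    have := HomBound.mul hC (by positivity) hρ ha ih
    rw [pow_succ', pow_succ']
    exact this

theorem HomBound.texp_smul {r : ℕ} {C ρ v : ℝ} (hC : 0 ≤ C) (hρ : 0 ≤ ρ) (hv0 : 0 ≤ v)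
    (hv1 : v ≤ 1) {a : TruncTensor ℓ N} (ha : HomBound r C ρ a) :
    HomBound r (∑ n ∈ Finset.range (N + 1), ((N + 1) * C) ^ n) ρ (texp (v • a)) := by
  intro w hw
  rw [coord_texp_smul, Finset.sum_mul]
  refine (Finset.abs_sum_le_sum_abs _ _).trans (Finset.sum_le_sum fun n _ => ?_)
  have h1 : |v ^ n| ≤ 1 := by
    rw [abs_of_nonneg (by positivity)]
    exact pow_le_one₀ hv0 hv1
  have h2 : |((n.factorial : ℝ)⁻¹)| ≤ 1 := by
    rw [abs_of_nonneg (by positivity)]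
    exact inv_le_one_of_one_le₀ (by exact_mod_cast Nat.one_le_iff_ne_zero.2 n.factorial_ne_zero)
  rw [abs_mul, abs_mul, ← mul_assoc]
  calc _ ≤ 1 * |(a ^ n).coord w| := by
        gcongr
        exact mul_le_one₀ h1 (abs_nonneg _) h2
    _ ≤ _ := by rw [one_mul]; exact ha.pow hC hρ n w hw

/-- The logarithm of `a` inherits the homogeneous bounds of `a`. -/
theorem exists_homBound_log (N : ℕ) (r : ℕ) : ∃ C : ℝ, 1 ≤ C ∧
    ∀ {ℓ : ℕ} (L : TruncTensor ℓ N) (ρ : ℝ), 0 ≤ ρ → L.coord [] = 0 →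
      HomBound N 1 ρ (texp L) → r ≤ N → HomBound r C ρ L := by
  induction r with
  | zero =>
    refine ⟨1, le_rfl, fun L ρ hρ h0 _ _ w hw => ?_⟩
    obtain rfl : w = [] := List.length_eq_zero_iff.1 (by omega)
    simp [h0]
  | succ r ih =>
    obtain ⟨C, hC1, hC⟩ := ih
    have hC0 : 0 ≤ C := by linarith
    -- The `1` bounds `texp L`, and the summand `n ≥ 2` is the constant of `HomBound.mul_succ` for
    -- `L * L ^ (n - 1)`. The summands `n = 0, 1` are harmless padding.
    refine ⟨1 + ∑ n ∈ Finset.range (N + 1), (N + 1) * C * ((N + 1) * C) ^ (n - 1), ?_, ?_⟩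
    · have : 0 ≤ ∑ n ∈ Finset.range (N + 1), (N + 1) * C * ((N + 1) * C) ^ (n - 1) :=
        Finset.sum_nonneg fun n _ => by positivity
      linarith
    intro ℓ L ρ hρ h0 hexp hr w hw
    have hLr := hC L ρ hρ h0 hexp (by omega)
    rcases eq_or_ne w [] with rfl | hne
    · rw [h0, abs_zero]
      have : 0 ≤ ∑ n ∈ Finset.range (N + 1), (N + 1) * C * ((N + 1) * C) ^ (n - 1) :=
        Finset.sum_nonneg fun n _ => by positivity
      positivity
    -- The exponential series is solved for its linear term. In degree `r + 1` the powers `L ^ n`,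
    -- `n ≥ 2`, only involve coordinates of degree at most `r`, and the term `n = 0` vanishes on a
    -- nonempty word.
    have hsum := coord_texp L w
    rw [← Finset.add_sum_erase _ _ (show 1 ∈ Finset.range (N + 1) by
      rw [Finset.mem_range]; omega)] at hsum
    simp only [Nat.factorial_one, Nat.cast_one, inv_one, one_mul, pow_one] at hsum
    have hrest : |∑ n ∈ (Finset.range (N + 1)).erase 1,
        ((n.factorial : ℝ)⁻¹) * (L ^ n).coord w|
        ≤ (∑ n ∈ Finset.range (N + 1), (N + 1) * C * ((N + 1) * C) ^ (n - 1))
          * ρ ^ w.length := by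
      refine (Finset.abs_sum_le_sum_abs _ _).trans ?_
      rw [Finset.sum_mul]
      refine (Finset.sum_le_sum fun n hn => ?_).trans
        (Finset.sum_le_sum_of_subset_of_nonneg (Finset.erase_subset 1 _)
          fun n _ _ => by positivity)
      rw [Finset.mem_erase] at hn
      rw [abs_mul]
      have h2 : |((n.factorial : ℝ)⁻¹)| ≤ 1 := by
        rw [abs_of_nonneg (by positivity)]
        exact inv_le_one_of_one_le₀
          (by exact_mod_cast Nat.one_le_iff_ne_zero.2 n.factorial_ne_zero)
      refine (mul_le_of_le_one_left (abs_nonneg _) h2).trans ?_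
      rcases Nat.eq_zero_or_pos n with rfl | hn0
      · rw [pow_zero, coord_one, if_neg hne, abs_zero]
        positivity
      · obtain ⟨m, rfl⟩ : ∃ m, n = m + 2 := ⟨n - 2, by have := hn.1; omega⟩
        have hp0 : (L ^ (m + 1)).coord [] = 0 := coord_pow_of_length_lt h0 _ (by simp)
        have := HomBound.mul_succ hC0 (by positivity) hρ hLr (hLr.pow hC0 hρ (m + 1)) h0 hp0
        rw [pow_succ']
        exact this w hw
    have ha := hexp w (by omega)
    have : L.coord w = (texp L).coord w - ∑ n ∈ (Finset.range (N + 1)).erase 1,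
        ((n.factorial : ℝ)⁻¹) * (L ^ n).coord w := by linarith
    rw [this, add_mul]
    exact (abs_sub _ _).trans (add_le_add ha hrest)

/-- Uniform homogeneous bounds for the logarithm and the one-parameter group it generates. -/
theorem exists_homBound (N : ℕ) : ∃ C : ℝ, 1 ≤ C ∧
    ∀ {ℓ : ℕ} (L : TruncTensor ℓ N) (ρ : ℝ), 0 ≤ ρ → L.coord [] = 0 →
      HomBound N 1 ρ (texp L) → HomBound N C ρ L ∧
      ∀ v : ℝ, 0 ≤ v → v ≤ 1 → HomBound N C ρ (texp (v • L)) ∧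
        HomBound N C ρ (L * texp (v • L)) := by
  obtain ⟨C, hC1, hC⟩ := exists_homBound_log N N
  have hC0 : 0 ≤ C := by linarith
  set D := ∑ n ∈ Finset.range (N + 1), ((N + 1) * C) ^ n with hD
  have hD0 : 0 ≤ D := Finset.sum_nonneg fun n _ => by positivity
  have mono : ∀ {ℓ : ℕ} {a : TruncTensor ℓ N} {B B' ρ : ℝ}, 0 ≤ ρ → B ≤ B' →
      HomBound N B ρ a → HomBound N B' ρ a := fun hρ hB h w hw =>
    (h w hw).trans (by gcongr)
  have hP : 0 ≤ (N + 1) * C * D := by positivity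
  refine ⟨C + D + (N + 1) * C * D, by linarith, fun L ρ hρ h0 hexp => ?_⟩
  have hL := hC L ρ hρ h0 hexp le_rfl
  refine ⟨mono hρ (by linarith) hL, fun v hv0 hv1 => ?_⟩
  have hE := hL.texp_smul hC0 hρ hv0 hv1
  exact ⟨mono hρ (by linarith) hE, mono hρ (by linarith) (HomBound.mul hC0 hD0 hρ hL hE)⟩

end Exponential

/-! ### Maps with bounded Hölder derivatives -/

section HolderBound

variable {E F : Type*} [NormedAddCommGroup E] [NormedSpace ℝ E]
  [NormedAddCommGroup F] [NormedSpace ℝ F]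

/-- The map `g` is `C^n`, and its derivatives of order at most `n` are bounded by `B` and
`α`-Hölder with constant `B`. -/
structure HolderBound (n : ℕ) (α B : ℝ) (g : E → F) : Prop where
  contDiff : ContDiff ℝ (n : ℕ) g
  bound : ∀ k ≤ n, ∀ x, ‖iteratedFDeriv ℝ k g x‖ ≤ B
  holder : ∀ k ≤ n, ∀ x y, ‖iteratedFDeriv ℝ k g x - iteratedFDeriv ℝ k g y‖ ≤ B * ‖x - y‖ ^ α

theorem HolderBound.mono {n : ℕ} {α B B' : ℝ} {g : E → F} (h : HolderBound n α B g)
    (hB : B ≤ B') : HolderBound n α B' g :=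
  ⟨h.contDiff, fun k hk x => (h.bound k hk x).trans hB,
    fun k hk x y => (h.holder k hk x y).trans (by gcongr)⟩

theorem HolderBound.of_le {n m : ℕ} {α B : ℝ} {g : E → F} (h : HolderBound n α B g)
    (hm : m ≤ n) : HolderBound m α B g :=
  ⟨h.contDiff.of_le (by exact_mod_cast hm), fun k hk => h.bound k (hk.trans hm),
    fun k hk => h.holder k (hk.trans hm)⟩

theorem HolderBound.norm_le {n : ℕ} {α B : ℝ} {g : E → F} (h : HolderBound n α B g) (x : E) :
    ‖g x‖ ≤ B := by
  simpa using h.bound 0 (Nat.zero_le _) x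

theorem HolderBound.norm_sub_le {n : ℕ} {α B : ℝ} {g : E → F} (h : HolderBound n α B g)
    (x y : E) : ‖g x - g y‖ ≤ B * ‖x - y‖ ^ α := by
  have := h.holder 0 (Nat.zero_le _) x y
  rwa [iteratedFDeriv_zero_eq_comp, Function.comp_apply, Function.comp_apply, ← map_sub,
    LinearIsometryEquiv.norm_map] at this

theorem HolderBound.norm_fderiv_le {n : ℕ} {α B : ℝ} {g : E → F} (h : HolderBound n α B g)
    (hn : 1 ≤ n) (x : E) : ‖fderiv ℝ g x‖ ≤ B := by
  simpa [norm_iteratedFDeriv_one] using h.bound 1 hn x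

theorem norm_iteratedFDeriv_fderiv_sub (g : E → F) (k : ℕ) (x y : E) :
    ‖iteratedFDeriv ℝ k (fderiv ℝ g) x - iteratedFDeriv ℝ k (fderiv ℝ g) y‖
      = ‖iteratedFDeriv ℝ (k + 1) g x - iteratedFDeriv ℝ (k + 1) g y‖ := by
  simp only [iteratedFDeriv_succ_eq_comp_right, Function.comp_apply]
  rw [← dist_eq_norm, ← dist_eq_norm, LinearIsometryEquiv.dist_map]

theorem HolderBound.fderiv {n : ℕ} {α B : ℝ} {g : E → F} (h : HolderBound (n + 1) α B g) :
    HolderBound n α B (fderiv ℝ g) where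
  contDiff := h.contDiff.fderiv_right (by norm_cast)
  bound k hk x := by
    rw [norm_iteratedFDeriv_fderiv]
    exact h.bound (k + 1) (by omega) x
  holder k hk x y := by
    rw [norm_iteratedFDeriv_fderiv_sub]
    exact h.holder (k + 1) (by omega) x y

theorem iteratedFDeriv_translate_sub {n : ℕ} {g : E → F} (hg : ContDiff ℝ (n : ℕ) g) {k : ℕ}
    (hk : k ≤ n) (z y : E) :
    iteratedFDeriv ℝ k (fun w => g (w + z) - g w) y
      = iteratedFDeriv ℝ k g (y + z) - iteratedFDeriv ℝ k g y := by
  have hg' : ContDiff ℝ (k : ℕ) g := hg.of_le (by exact_mod_cast hk)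
  have h1 : ContDiff ℝ (k : ℕ) fun w => g (w + z) := hg'.comp (contDiff_id.add contDiff_const)
  change iteratedFDeriv ℝ k ((fun w => g (w + z)) - g) y = _
  rw [iteratedFDeriv_sub_apply h1.contDiffAt hg'.contDiffAt, iteratedFDeriv_comp_add_right]

/-- Hölder bounds for derivatives are sup bounds for derivatives of `g(· + z) - g`, so one Leibniz
estimate serves for both. The increment of the product splits into two terms, each carrying the
increment of one factor; together they turn the Leibniz constant `2 ^ n` into `2 ^ (n + 1)`. -/
theorem HolderBound.clm_apply {G : Type*} [NormedAddCommGroup G] [NormedSpace ℝ G]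
    {n : ℕ} {α B K : ℝ} (hB : 0 ≤ B) (hK : 0 ≤ K)
    {f : E → F →L[ℝ] G} {g : E → F} (hf : HolderBound n α B f) (hg : HolderBound n α K g) :
    HolderBound n α (2 ^ (n + 1) * B * K) fun x => f x (g x) := by
  have leibniz : ∀ {f : E → F →L[ℝ] G} {g : E → F} {b c : ℝ}, 0 ≤ b → 0 ≤ c →
      ContDiff ℝ (n : ℕ) f → ContDiff ℝ (n : ℕ) g → ∀ k ≤ n, ∀ x,
      (∀ i ≤ n, ‖iteratedFDeriv ℝ i f x‖ ≤ b) → (∀ i ≤ n, ‖iteratedFDeriv ℝ i g x‖ ≤ c) →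
      ‖iteratedFDeriv ℝ k (fun x => f x (g x)) x‖ ≤ 2 ^ n * b * c := by
    intro f g b c hb hc hf hg k hk x h1 h2
    refine (norm_iteratedFDeriv_clm_apply hf hg x (by exact_mod_cast hk)).trans ?_
    calc _ ≤ ∑ i ∈ Finset.range (k + 1), (k.choose i : ℝ) * (b * c) := by
          refine Finset.sum_le_sum fun i hi => ?_
          rw [Finset.mem_range] at hi
          rw [mul_assoc]
          have := h1 i (by omega)
          have := h2 (k - i) (by omega)
          gcongr
      _ = 2 ^ k * (b * c) := by
          rw [← Finset.sum_mul]
          congr 1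
          exact_mod_cast Nat.sum_range_choose k
      _ ≤ 2 ^ n * (b * c) := by
          gcongr
          norm_num
      _ = _ := by ring
  have hcd : ContDiff ℝ (n : ℕ) fun x => f x (g x) := hf.contDiff.clm_apply hg.contDiff
  refine ⟨hcd, fun k hk x => ?_, fun k hk x y => ?_⟩
  · refine (leibniz hB hK hf.contDiff hg.contDiff k hk x (fun i hi => hf.bound i hi x)
      fun i hi => hg.bound i hi x).trans ?_
    gcongr
    · norm_num
    · omega
  · obtain ⟨z, rfl⟩ : ∃ z, x = y + z := ⟨x - y, by abel⟩
    rw [← iteratedFDeriv_translate_sub hcd hk, add_sub_cancel_left]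
    have ht : ContDiff ℝ (n : ℕ) fun w : E => w + z := contDiff_id.add contDiff_const
    have c1 : ContDiff ℝ (n : ℕ) fun w => f (w + z) - f w :=
      (hf.contDiff.comp ht).sub hf.contDiff
    have c2 : ContDiff ℝ (n : ℕ) fun w => g (w + z) := hg.contDiff.comp ht
    have c3 : ContDiff ℝ (n : ℕ) fun w => g (w + z) - g w := c2.sub hg.contDiff
    have hsplit : (fun w => f (w + z) (g (w + z)) - f w (g w))
        = (fun w => (f (w + z) - f w) (g (w + z))) + fun w => f w (g (w + z) - g w) := by
      funext w
      simp
    have hk' : ((k : ℕ) : WithTop ℕ∞) ≤ (n : ℕ) := by exact_mod_cast hk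
    rw [hsplit, iteratedFDeriv_add_apply ((c1.clm_apply c2).of_le hk').contDiffAt
      ((hf.contDiff.clm_apply c3).of_le hk').contDiffAt]
    have hz : 0 ≤ ‖z‖ ^ α := by positivity
    have e1 := leibniz (b := B * ‖z‖ ^ α) (c := K) (by positivity) hK c1 c2 k hk y
      (fun i hi => by
        rw [iteratedFDeriv_translate_sub hf.contDiff hi]
        simpa using hf.holder i hi (y + z) y)
      (fun i hi => by
        rw [iteratedFDeriv_comp_add_right]
        exact hg.bound i hi _)
    have e2 := leibniz (b := B) (c := K * ‖z‖ ^ α) hB (by positivity) hf.contDiff c3 k hk y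
      (fun i hi => hf.bound i hi y)
      (fun i hi => by
        rw [iteratedFDeriv_translate_sub hg.contDiff hi]
        simpa using hg.holder i hi (y + z) y)
    refine (norm_add_le _ _).trans ((add_le_add e1 e2).trans (le_of_eq ?_))
    ring

theorem le_gammaNorm_of_isGammaLipschitz {γ : ℝ} {g : E → F} (h : IsGammaLipschitz γ g) {k : ℕ}
    (hk : k ≤ ⌊γ⌋₊) (x : E) : ‖iteratedFDeriv ℝ k g x‖ ≤ gammaNorm γ g := by
  have h1 : ‖iteratedFDeriv ℝ k g x‖ₑ ≤ eGammaNorm γ g := by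
    refine le_trans ?_ (le_self_add : _ ≤ eGammaNorm γ g)
    refine (le_iSup (fun x => ‖iteratedFDeriv ℝ k g x‖ₑ) x).trans ?_
    exact Finset.single_le_sum (f := fun r => ⨆ x, ‖iteratedFDeriv ℝ r g x‖ₑ)
      (fun _ _ => zero_le) (Finset.mem_range.2 (by omega))
  have h2 := ENNReal.toReal_mono h.2.ne h1
  rwa [toReal_enorm] at h2

theorem holder_of_isGammaLipschitz {γ : ℝ} {g : E → F} (h : IsGammaLipschitz γ g) (x y : E) :
    ‖iteratedFDeriv ℝ ⌊γ⌋₊ g x - iteratedFDeriv ℝ ⌊γ⌋₊ g y‖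
      ≤ gammaNorm γ g * ‖x - y‖ ^ Int.fract γ := by
  have h1 : eHolderNorm (Real.toNNReal (Int.fract γ)) (iteratedFDeriv ℝ ⌊γ⌋₊ g)
      ≤ eGammaNorm γ g := le_add_self
  have hm : MemHolder (Real.toNNReal (Int.fract γ)) (iteratedFDeriv ℝ ⌊γ⌋₊ g) :=
    eHolderNorm_lt_top.1 (h1.trans_lt h.2)
  have h2 := hm.holderWith.dist_le x y
  rw [dist_eq_norm, dist_eq_norm, Real.coe_toNNReal _ (Int.fract_nonneg γ)] at h2
  refine h2.trans ?_
  gcongr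
  exact ENNReal.toReal_mono h.2.ne h1

/-- Below the top order, points at distance at least `1` are handled by the sup bound, which costs
the factor `2`, and closer points by the mean value inequality with the next derivative. -/
theorem IsGammaLipschitz.holderBound {γ B : ℝ} {g : E → F} (h : IsGammaLipschitz γ g)
    (hB : gammaNorm γ g ≤ B) : HolderBound ⌊γ⌋₊ (Int.fract γ) (2 * B) g := by
  have hB0 : 0 ≤ B := ENNReal.toReal_nonneg.trans hB
  refine ⟨h.1, fun k hk x => ?_, fun k hk x y => ?_⟩
  · have := le_gammaNorm_of_isGammaLipschitz h hk x
    linarith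
  · have hα0 := Int.fract_nonneg γ
    have hα1 := (Int.fract_lt_one γ).le
    rcases hk.eq_or_lt with rfl | hk
    · refine (holder_of_isGammaLipschitz h x y).trans ?_
      gcongr
      linarith
    rcases le_total 1 ‖x - y‖ with hd | hd
    · have h1 := le_gammaNorm_of_isGammaLipschitz h hk.le x
      have h2 := le_gammaNorm_of_isGammaLipschitz h hk.le y
      have h3 : 1 ≤ ‖x - y‖ ^ Int.fract γ := Real.one_le_rpow hd hα0
      calc _ ≤ ‖iteratedFDeriv ℝ k g x‖ + ‖iteratedFDeriv ℝ k g y‖ := norm_sub_le _ _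
        _ ≤ 2 * B * 1 := by linarith
        _ ≤ _ := by gcongr
    · have h1 : ‖iteratedFDeriv ℝ k g x - iteratedFDeriv ℝ k g y‖ ≤ B * ‖x - y‖ := by
        refine Convex.norm_image_sub_le_of_norm_fderiv_le (𝕜 := ℝ) (s := Set.univ)
          (fun w _ => ?_) (fun w _ => ?_) convex_univ trivial trivial
        · exact (h.1.differentiable_iteratedFDeriv (by exact_mod_cast hk)).differentiableAt
        · rw [norm_fderiv_iteratedFDeriv]
          exact (le_gammaNorm_of_isGammaLipschitz h hk w).trans hB
      have h2 : ‖x - y‖ ≤ ‖x - y‖ ^ Int.fract γ := by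
        rcases (norm_nonneg (x - y)).eq_or_lt with h0 | h0
        · rw [← h0]; positivity
        · calc ‖x - y‖ = ‖x - y‖ ^ (1 : ℝ) := (Real.rpow_one _).symm
            _ ≤ _ := Real.rpow_le_rpow_of_exponent_ge h0 hd hα1
      have h3 : 0 ≤ ‖x - y‖ ^ Int.fract γ := by positivity
      calc _ ≤ B * ‖x - y‖ := h1
        _ ≤ B * ‖x - y‖ ^ Int.fract γ := by gcongr
        _ ≤ _ := by nlinarith

end HolderBound

/-! ### Iterated derivatives along words and iterated brackets -/

section WordDerivative

variable {E : Type*} [NormedAddCommGroup E] [NormedSpace ℝ E]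
  {F : Type*} [NormedAddCommGroup F] [NormedSpace ℝ F] {ℓ N : ℕ}

/-- The operator `V_I`, acting on maps with values in a normed space. -/
noncomputable def wordDerivMap (W : Fin ℓ → E → E) : List (Fin ℓ) → (E → F) → E → F
  | [], g => g
  | i :: I, g => fun x => fderiv ℝ (wordDerivMap W I g) x (W i x)

theorem wordDeriv_eq_wordDerivMap (W : Fin ℓ → E → E) (f : E → ℝ) :
    ∀ I : List (Fin ℓ), wordDeriv W I f = wordDerivMap W I f
  | [] => rfl
  | i :: I => by
    rw [wordDeriv, wordDeriv_eq_wordDerivMap W f I]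
    rfl

theorem wordDerivMap_append (W : Fin ℓ → E → E) (g : E → F) (J : List (Fin ℓ)) :
    ∀ I : List (Fin ℓ), wordDerivMap W (I ++ J) g = wordDerivMap W I (wordDerivMap W J g)
  | [] => rfl
  | i :: I => by
    rw [List.cons_append, wordDerivMap, wordDerivMap_append W g J I]
    rfl

/-- The field of a letter is differentiated only by the letters to its left, hence at most `|I| - 1`
times. This is why fields of class `C^n` allow words of length `n + 1`; the same count governs
`contDiff_bracketField`. -/
theorem contDiff_wordDerivMap {W : Fin ℓ → E → E} {g : E → F} {n : ℕ}
    (hW : ∀ i, ContDiff ℝ (n : ℕ) (W i)) :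
    ∀ (I : List (Fin ℓ)) {m : ℕ}, m + I.length ≤ n + 1 → ContDiff ℝ (m + I.length : ℕ) g →
      ContDiff ℝ (m : ℕ) (wordDerivMap W I g)
  | [], _, _, hg => hg
  | i :: I, m, hm, hg => by
    rw [List.length_cons] at hm hg
    have ih : ContDiff ℝ (m + 1 : ℕ) (wordDerivMap W I g) :=
      contDiff_wordDerivMap hW I (by omega) (by convert hg using 2; omega)
    have h1 : ContDiff ℝ (m : ℕ) (fderiv ℝ (wordDerivMap W I g)) :=
      ih.fderiv_right (by norm_cast)
    exact h1.clm_apply ((hW i).of_le (by exact_mod_cast (by omega : m ≤ n)))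

theorem contDiff_bracketField {W : Fin ℓ → E → E} {n : ℕ} (hW : ∀ i, ContDiff ℝ (n : ℕ) (W i)) :
    ∀ (I : List (Fin ℓ)) {m : ℕ}, m + I.length ≤ n + 1 → ContDiff ℝ (m : ℕ) (bracketField W I)
  | [], _, _ => contDiff_const
  | [i], m, hm => by
    rw [List.length_singleton] at hm
    exact (hW i).of_le (by exact_mod_cast (by omega : m ≤ n))
  | i :: j :: I, m, hm => by
    rw [List.length_cons] at hm
    have ih : ContDiff ℝ (m + 1 : ℕ) (bracketField W (j :: I)) :=
      contDiff_bracketField hW (j :: I) (by omega)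
    have hi : ContDiff ℝ (m + 1 : ℕ) (W i) := by
      refine (hW i).of_le ?_
      rw [List.length_cons] at hm
      exact_mod_cast (by omega : m + 1 ≤ n)
    exact hi.lieBracket_vectorField ih (by norm_cast)

/-- The Lie bracket acts on maps as the commutator of the actions. -/
theorem fderiv_apply_lieBracket {A B : E → E} {g : E → F} (hA : Differentiable ℝ A)
    (hB : Differentiable ℝ B) (hg : ContDiff ℝ 2 g) (x : E) :
    fderiv ℝ g x (VectorField.lieBracket ℝ A B x)
      = fderiv ℝ (fun y => fderiv ℝ g y (B y)) x (A x)
        - fderiv ℝ (fun y => fderiv ℝ g y (A y)) x (B x) := by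
  have hg' : Differentiable ℝ (fderiv ℝ g) :=
    (hg.fderiv_right (m := 1) (by norm_num)).differentiable (by norm_num)
  have hsymm : IsSymmSndFDerivAt ℝ g x :=
    hg.contDiffAt.isSymmSndFDerivAt (by simp)
  have key : ∀ {C : E → E}, Differentiable ℝ C → ∀ v,
      fderiv ℝ (fun y => fderiv ℝ g y (C y)) x v
        = fderiv ℝ g x (fderiv ℝ C x v) + fderiv ℝ (fderiv ℝ g) x v (C x) := by
    intro C hC v
    rw [((hg' x).hasFDerivAt.clm_apply (hC x).hasFDerivAt).fderiv]
    simp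
  rw [key hB, key hA, VectorField.lieBracket_eq, map_sub, hsymm.eq (A x) (B x)]
  abel

/-- The vector field `V_{[I]}` acts on maps as the differential operator with the coordinates of
`e_{[I]}`. -/
theorem fderiv_apply_bracketField {W : Fin ℓ → E → E} :
    ∀ (I : List (Fin ℓ)) {n : ℕ}, (∀ i, ContDiff ℝ (n : ℕ) (W i)) → I ≠ [] →
      I.length ≤ n + 1 → I.length ≤ N → ∀ {g : E → F}, ContDiff ℝ (I.length : ℕ) g → ∀ x,
      fderiv ℝ g x (bracketField W I x)
        = ∑ w ∈ words ℓ I.length, (bracketWord N I).coord w • wordDerivMap W w g x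
  | [], _, _, h, _, _, _, _, _ => absurd rfl h
  | [i], _, _, _, _, hN, g, _, x => by
    rw [List.length_singleton, Finset.sum_eq_single [i]]
    · simp [bracketWord, coord_letter hN, bracketField, wordDerivMap]
    · intro w _ hw
      simp [bracketWord, coord_letter hN, hw]
    · simp
  | i :: j :: I, n, hW, _, hn, hN, g, hg, x => by
    rw [List.length_cons] at hn hN hg
    have hl : 1 ≤ (j :: I).length := by simp
    have hlen : (i :: j :: I).length = (j :: I).length + 1 := rfl
    have hB : ContDiff ℝ (1 : ℕ) (bracketField W (j :: I)) :=
      contDiff_bracketField hW (j :: I) (by omega)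
    have hB' : Differentiable ℝ (bracketField W (j :: I)) := hB.differentiable (by norm_num)
    have hWi : ContDiff ℝ (1 : ℕ) (W i) := (hW i).of_le (by exact_mod_cast (by omega : 1 ≤ n))
    have hWi' : Differentiable ℝ (W i) := hWi.differentiable (by norm_num)
    have hg2 : ContDiff ℝ 2 g :=
      hg.of_le (by exact_mod_cast (by omega : 2 ≤ (j :: I).length + 1))
    have hgi : ContDiff ℝ ((j :: I).length : ℕ) (wordDerivMap W [i] g) :=
      contDiff_wordDerivMap hW [i] (by rw [List.length_singleton]; omega) hg
    have ih1 : (fun y => fderiv ℝ g y (bracketField W (j :: I) y)) = fun y =>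
        ∑ w ∈ words ℓ (j :: I).length, (bracketWord N (j :: I)).coord w • wordDerivMap W w g y :=
      funext fun y => fderiv_apply_bracketField (j :: I) hW (by simp) (by omega) (by omega)
        (hg.of_le (by exact_mod_cast Nat.le_succ _)) y
    -- The induction hypothesis for `V_i g` in place of `g` produces the words `w ++ [i]`, that is,
    -- the part `e_{[J]} e_i` of the commutator.
    have ih2 := fderiv_apply_bracketField (j :: I) hW (by simp) (by omega) (by omega) hgi x
    have hdiff : ∀ w ∈ words ℓ (j :: I).length, DifferentiableAt ℝ (wordDerivMap W w g) x := by
      intro w hw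
      rw [mem_words] at hw
      have : ContDiff ℝ (1 : ℕ) (wordDerivMap W w g) :=
        contDiff_wordDerivMap hW w (by omega) (by rw [hw, add_comm]; exact hg)
      exact this.differentiable (by norm_num) x
    rw [bracketField, fderiv_apply_lieBracket hWi' hB' hg2, ih1, bracketWord, hlen,
      sum_coord_lie_letter i _ hN]
    congr 1
    · have hd : HasFDerivAt (fun y => ∑ w ∈ words ℓ (j :: I).length,
          (bracketWord N (j :: I)).coord w • wordDerivMap W w g y)
          (∑ w ∈ words ℓ (j :: I).length,
            (bracketWord N (j :: I)).coord w • fderiv ℝ (wordDerivMap W w g) x) x :=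
        HasFDerivAt.fun_sum fun w hw => (hdiff w hw).hasFDerivAt.const_smul _
      rw [hd.fderiv, _root_.sum_apply]
      rfl
    · simp only [wordDerivMap_append]
      exact ih2

/-- The vector field `∑_{|I| = k} Λ^I V_{[I]}`. -/
noncomputable def levelField (W : Fin ℓ → E → E) (Λ : List (Fin ℓ) → ℝ) (k : ℕ) (x : E) : E :=
  ∑ I ∈ words ℓ k, Λ I • bracketField W I x

theorem logODEField_eq (V : E → E) (W : Fin ℓ → E → E) (h : ℝ) (Λ : List (Fin ℓ) → ℝ) (x : E) :
    logODEField N V W h Λ x = h • V x + ∑ k ∈ Finset.Icc 1 N, levelField W Λ k x := by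
  unfold logODEField levelField
  simp only [sum_ofFn_eq_sum_words _ fun I => Λ I • bracketField W I x]

theorem fderiv_apply_levelField {W : Fin ℓ → E → E} {n k : ℕ}
    (hW : ∀ i, ContDiff ℝ (n : ℕ) (W i)) (Λ : List (Fin ℓ) → ℝ) (hk1 : 1 ≤ k) (hkn : k ≤ n + 1)
    (hkN : k ≤ N) {g : E → F} (hg : ContDiff ℝ (k : ℕ) g) (x : E) :
    fderiv ℝ g x (levelField W Λ k x)
      = ∑ w ∈ words ℓ k, (lieElement N Λ).coord w • wordDerivMap W w g x := by
  have h1 : ∀ I ∈ words ℓ k, fderiv ℝ g x (Λ I • bracketField W I x)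
      = ∑ w ∈ words ℓ k, (Λ I * (bracketWord N I).coord w) • wordDerivMap W w g x := by
    intro I hI
    rw [mem_words] at hI
    subst hI
    rw [map_smul, fderiv_apply_bracketField (N := N) I hW (List.length_pos_iff.1 hk1) hkn hkN hg,
      Finset.smul_sum]
    simp only [mul_smul]
  rw [levelField, map_sum, Finset.sum_congr rfl h1, Finset.sum_comm]
  refine Finset.sum_congr rfl fun w hw => ?_
  rw [mem_words] at hw
  rw [coord_lieElement Λ hk1 hkN hw, Finset.sum_smul]

/-- A field is recovered by letting it act on the identity map. Since `Λ` is not determined by the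
increment, bounds on the field must come from the coordinates of `lieElement N Λ`, and this formula
makes that possible. -/
theorem levelField_eq {W : Fin ℓ → E → E} {n k : ℕ}
    (hW : ∀ i, ContDiff ℝ (n : ℕ) (W i)) (Λ : List (Fin ℓ) → ℝ) (hk1 : 1 ≤ k) (hkn : k ≤ n + 1)
    (hkN : k ≤ N) (x : E) :
    levelField W Λ k x
      = ∑ w ∈ words ℓ k, (lieElement N Λ).coord w • wordDerivMap W w id x := by
  rw [← fderiv_apply_levelField hW Λ hk1 hkn hkN contDiff_id, fderiv_id]
  rfl

theorem HolderBound.wordDerivMap {W : Fin ℓ → E → E} {g : E → F} {n : ℕ} {α B K : ℝ}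
    (hB : 0 ≤ B) (hK : 0 ≤ K) (hW : ∀ i, HolderBound n α K (W i)) :
    ∀ (I : List (Fin ℓ)) {m : ℕ}, m + I.length ≤ n + 1 → HolderBound (m + I.length) α B g →
      HolderBound m α ((2 ^ (n + 1) * K) ^ I.length * B) (wordDerivMap W I g)
  | [], _, _, hg => by simpa [_root_.wordDerivMap] using hg
  | i :: I, m, hm, hg => by
    rw [List.length_cons] at hm hg
    have ih : HolderBound (m + 1) α _ (_root_.wordDerivMap W I g) :=
      HolderBound.wordDerivMap hB hK hW I (by omega) (by convert hg using 1; omega)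
    have h := ih.fderiv.clm_apply (by positivity) hK ((hW i).of_le (by omega : m ≤ n))
    refine h.mono ?_
    rw [List.length_cons, pow_succ]
    have h2 : (2 : ℝ) ^ (m + 1) ≤ 2 ^ (n + 1) :=
      pow_le_pow_right₀ (by norm_num) (by omega)
    calc _ ≤ 2 ^ (n + 1) * ((2 ^ (n + 1) * K) ^ I.length * B) * K :=
          mul_le_mul_of_nonneg_right (mul_le_mul_of_nonneg_right h2 (by positivity)) hK
      _ = _ := by ring

end WordDerivative

/-! ### Peano's theorem for the sum of a Lipschitz and of a compact vector field -/

section Peano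

open Filter Topology MeasureTheory

variable {E : Type*} [NormedAddCommGroup E]

/-- The step function with value `c k` on `[k/(n+1), (k+1)/(n+1))`. -/
noncomputable def stepFun {E : Type*} (n : ℕ) (c : ℕ → E) (r : ℝ) : E := c ⌊((n : ℝ) + 1) * r⌋₊

theorem stronglyMeasurable_stepFun (n : ℕ) (c : ℕ → E) : StronglyMeasurable (stepFun n c) := by
  have h : Measurable fun r : ℝ => ⌊((n : ℝ) + 1) * r⌋₊ :=
    Nat.measurable_floor.comp (measurable_const.mul measurable_id)
  exact (StronglyMeasurable.of_discrete (f := c)).comp_measurable h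

theorem intervalIntegrable_stepFun {n : ℕ} {c : ℕ → E} {M : ℝ} (hc : ∀ k, ‖c k‖ ≤ M) (a b : ℝ) :
    IntervalIntegrable (stepFun n c) volume a b := by
  rw [intervalIntegrable_iff]
  exact Measure.integrableOn_of_bounded (M := M) (by simp [Set.uIoc])
    (stronglyMeasurable_stepFun n c).aestronglyMeasurable (Eventually.of_forall fun r => hc _)

theorem stepFun_eq_of_mem {E : Type*} {n k : ℕ} {c : ℕ → E} {r : ℝ}
    (hr : r ∈ Set.Ico ((k : ℝ) / (n + 1)) (((k : ℝ) + 1) / (n + 1))) : stepFun n c r = c k := by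
  have hn : (0 : ℝ) < n + 1 := by positivity
  have h1 : (k : ℝ) ≤ (n + 1) * r := by
    have := (div_le_iff₀ hn).1 hr.1
    linarith
  have h2 : ((n : ℝ) + 1) * r < k + 1 := by
    have := (lt_div_iff₀ hn).1 hr.2
    linarith
  unfold stepFun
  rw [(Nat.floor_eq_iff ((Nat.cast_nonneg k).trans h1)).2 ⟨h1, h2⟩]

theorem mem_Ico_floor (n : ℕ) {r : ℝ} (hr : 0 ≤ r) :
    r ∈ Set.Ico ((⌊((n : ℝ) + 1) * r⌋₊ : ℝ) / (n + 1))
      (((⌊((n : ℝ) + 1) * r⌋₊ : ℝ) + 1) / (n + 1)) := by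
  have hn : (0 : ℝ) < n + 1 := by positivity
  refine ⟨(div_le_iff₀ hn).2 ?_, (lt_div_iff₀ hn).2 ?_⟩
  · have := Nat.floor_le (a := ((n : ℝ) + 1) * r) (by positivity)
    linarith
  · have := Nat.lt_floor_add_one (((n : ℝ) + 1) * r)
    linarith

theorem continuousWithinAt_stepFun (n : ℕ) (c : ℕ → E) {t : ℝ} (ht : 0 ≤ t) :
    ContinuousWithinAt (stepFun n c) (Set.Ioi t) t := by
  have hm := mem_Ico_floor n ht
  have : stepFun n c =ᶠ[𝓝[>] t] fun _ => stepFun n c t := by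
    filter_upwards [Ioo_mem_nhdsGT hm.2] with r hr
    rw [stepFun_eq_of_mem ⟨hm.1.trans hr.1.le, hr.2⟩]
    rfl
  exact continuousWithinAt_const.congr_of_eventuallyEq this rfl

variable [NormedSpace ℝ E]

theorem hasDerivWithinAt_integral_stepFun [CompleteSpace E] {n : ℕ} {c : ℕ → E} {M : ℝ}
    (hc : ∀ k, ‖c k‖ ≤ M) {t : ℝ} (ht : 0 ≤ t) :
    HasDerivWithinAt (fun u => ∫ r in (0 : ℝ)..u, stepFun n c r) (stepFun n c t) (Set.Ici t) t :=
  intervalIntegral.integral_hasDerivWithinAt_right (intervalIntegrable_stepFun hc 0 t)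
    (stronglyMeasurable_stepFun n c).stronglyMeasurableAtFilter (continuousWithinAt_stepFun n c ht)

theorem norm_integral_stepFun_sub_le {n : ℕ} {c : ℕ → E} {M : ℝ} (hc : ∀ k, ‖c k‖ ≤ M)
    (u v : ℝ) : ‖(∫ r in (0 : ℝ)..u, stepFun n c r) - ∫ r in (0 : ℝ)..v, stepFun n c r‖
      ≤ M * |u - v| := by
  rw [intervalIntegral.integral_interval_sub_left (intervalIntegrable_stepFun hc 0 u)
    (intervalIntegrable_stepFun hc 0 v)]
  exact intervalIntegral.norm_integral_le_of_norm_le_const fun r _ => hc _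

/-- The Euler scheme with step `1/(n+1)`. -/
noncomputable def eulerNode (F : E → E) (x : E) (n : ℕ) : ℕ → E
  | 0 => x
  | k + 1 => eulerNode F x n k + ((n : ℝ) + 1)⁻¹ • F (eulerNode F x n k)

theorem eulerNode_eq_integral [CompleteSpace E] {F : E → E} {P : ℝ} (hF : ∀ x, ‖F x‖ ≤ P) (x : E) (n k : ℕ) :
    eulerNode F x n k
      = x + ∫ r in (0 : ℝ)..(k : ℝ) / (n + 1), stepFun n (fun k => F (eulerNode F x n k)) r := by
  have hn : (0 : ℝ) < n + 1 := by positivity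
  induction k with
  | zero => simp [eulerNode]
  | succ k ih =>
    have hb : ∀ k, ‖F (eulerNode F x n k)‖ ≤ P := fun k => hF _
    have hle : (k : ℝ) / (n + 1) ≤ ((k : ℝ) + 1) / (n + 1) := by gcongr; linarith
    have h1 : ∫ r in (k : ℝ) / (n + 1)..((k : ℝ) + 1) / (n + 1),
        stepFun n (fun k => F (eulerNode F x n k)) r
        = ∫ r in (k : ℝ) / (n + 1)..((k : ℝ) + 1) / (n + 1), F (eulerNode F x n k) := by
      refine intervalIntegral.integral_congr_uIoo fun r hr => ?_
      rw [Set.uIoo_of_le hle] at hr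
      exact stepFun_eq_of_mem ⟨hr.1.le, hr.2⟩
    have h2 := intervalIntegral.integral_add_adjacent_intervals
      (intervalIntegrable_stepFun (n := n) hb 0 ((k : ℝ) / (n + 1)))
      (intervalIntegrable_stepFun (n := n) hb ((k : ℝ) / (n + 1)) (((k : ℝ) + 1) / (n + 1)))
    push_cast
    rw [← h2, ← add_assoc, ← ih, h1, intervalIntegral.integral_const, eulerNode]
    congr 2
    field_simp
    ring

/-- Linearity in `ε` lets Gronwall's bound tend to zero with the defects of the Euler polygons. -/
theorem gronwallBound_zero_eq (κ ε t : ℝ) :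
    gronwallBound 0 κ ε t = ε * gronwallBound 0 κ 1 t := by
  unfold gronwallBound
  split_ifs <;> ring

/-- The primitive of a function with values in a closed absolutely convex set. -/
theorem integral_stepFun_mem [CompleteSpace E] {n : ℕ} {c : ℕ → E} {M : ℝ}
    (hc : ∀ k, ‖c k‖ ≤ M) {S : Set E} (hS : AbsConvex ℝ S) (hSc : IsClosed S)
    (h : ∀ r ∈ Set.Icc (0 : ℝ) 1, stepFun n c r ∈ S) {u : ℝ} (hu : u ∈ Set.Icc (0 : ℝ) 1) :
    ∫ r in (0 : ℝ)..u, stepFun n c r ∈ S := by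
  -- The integral over `[0,u]` is `u` times an average over `[0,1]`. The average stays in `S` by
  -- convexity and closedness, and the factor `u ≤ 1` is absorbed because `S` is balanced.
  have h1 := intervalIntegral.smul_integral_comp_mul_left (a := 0) (b := 1) (stepFun n c) u
  rw [mul_zero, mul_one] at h1
  rw [← h1]
  refine hS.1.smul_mem (by rw [Real.norm_of_nonneg hu.1]; exact hu.2) ?_
  rw [intervalIntegral.integral_of_le zero_le_one]
  have : IsProbabilityMeasure (volume.restrict (Set.Ioc (0 : ℝ) 1)) := ⟨by simp⟩
  refine hS.2.integral_mem hSc ?_ ?_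
  · filter_upwards [ae_restrict_mem measurableSet_Ioc] with r hr
    exact h _ ⟨mul_nonneg hu.1 hr.1.le, mul_le_one₀ hu.2 hr.1.le hr.2⟩
  · refine Integrable.of_bound ?_ M (Eventually.of_forall fun r => hc _)
    exact ((stronglyMeasurable_stepFun n c).comp_measurable
      (measurable_const.mul measurable_id)).aestronglyMeasurable

/-- A map sending every ball into a compact set. -/
def IsCompactOnBalls (G : E → E) : Prop :=
  ∀ (y₀ : E) (R : ℝ), ∃ C : Set E, IsCompact C ∧ Set.MapsTo G (Metric.closedBall y₀ R) C

/-- Peano's theorem fails in infinite dimension, but compactness of `G` is enough. Each Euler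
polygon splits as `U + Z`, with `Z` the primitive of the `G` part. The `Z` take values in the closed
absolutely convex hull of a compact set, so Arzelà–Ascoli extracts a uniform limit `ζ`. The `U` then
nearly solve `U' = A(U + ζ)`, a Lipschitz equation, and converge by Gronwall. -/
theorem exists_hasDerivWithinAt_of_lipschitz_add_compact [CompleteSpace E] {A G : E → E}
    {κ : ℝ≥0} {M : ℝ} (hA : LipschitzWith κ A) (hAM : ∀ x, ‖A x‖ ≤ M) (hG : Continuous G)
    (hGM : ∀ x, ‖G x‖ ≤ M) (hGc : IsCompactOnBalls G) (x : E) :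
    ∃ y : ℝ → E, y 0 = x ∧ ∀ u ∈ Set.Icc (0 : ℝ) 1,
      HasDerivWithinAt y (A (y u) + G (y u)) (Set.Icc 0 1) u := by
  have hM : 0 ≤ M := (norm_nonneg _).trans (hGM x)
  set F : E → E := fun y => A y + G y with hFdef
  set P := M + M with hP
  have hFP : ∀ y, ‖F y‖ ≤ P := fun y => (norm_add_le _ _).trans (add_le_add (hAM y) (hGM y))
  have hFc : Continuous F := hA.continuous.add hG
  set a : ℕ → ℕ → E := fun n => eulerNode F x n with ha
  have haF : ∀ n k, ‖F (a n k)‖ ≤ P := fun n k => hFP _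
  have haA : ∀ n k, ‖A (a n k)‖ ≤ M := fun n k => hAM _
  have haG : ∀ n k, ‖G (a n k)‖ ≤ M := fun n k => hGM _
  -- the polygons and their two parts
  set Y : ℕ → ℝ → E := fun n u => x + ∫ r in (0 : ℝ)..u, stepFun n (fun k => F (a n k)) r with hY
  set Z : ℕ → ℝ → E := fun n u => ∫ r in (0 : ℝ)..u, stepFun n (fun k => G (a n k)) r with hZ
  set U : ℕ → ℝ → E := fun n u => x + ∫ r in (0 : ℝ)..u, stepFun n (fun k => A (a n k)) r with hU
  have hYUZ : ∀ n u, Y n u = U n u + Z n u := by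
    intro n u
    have := intervalIntegral.integral_add (intervalIntegrable_stepFun (n := n) (haA n) 0 u)
      (intervalIntegrable_stepFun (n := n) (haG n) 0 u)
    simp only [hY, hU, hZ]
    rw [add_assoc, ← this]
    rfl
  have hYlip : ∀ n u v, ‖Y n u - Y n v‖ ≤ P * |u - v| := by
    intro n u v
    simp only [hY]
    rw [add_sub_add_left_eq_sub]
    exact norm_integral_stepFun_sub_le (haF n) u v
  have hZlip : ∀ n u v, ‖Z n u - Z n v‖ ≤ M * |u - v| := fun n u v =>
    norm_integral_stepFun_sub_le (haG n) u v
  have hY0 : ∀ n, Y n 0 = x := fun n => by simp [hY]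
  have hnode : ∀ n r, stepFun n (a n) r = Y n ((⌊((n : ℝ) + 1) * r⌋₊ : ℝ) / (n + 1)) :=
    fun n r => eulerNode_eq_integral hFP x n _
  have hclose : ∀ n r, 0 ≤ r → ‖stepFun n (a n) r - Y n r‖ ≤ P / (n + 1) := by
    intro n r hr
    have hm := mem_Ico_floor n hr
    rw [add_div] at hm
    rw [hnode]
    refine (hYlip _ _ _).trans ?_
    rw [div_eq_mul_one_div P]
    refine mul_le_mul_of_nonneg_left ?_ (by positivity)
    rw [abs_le]
    constructor
    · linarith [hm.2]
    · have : (0 : ℝ) ≤ 1 / (n + 1) := by positivity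
      linarith [hm.1]
  -- On `[0,1]` the scheme of speed at most `P` stays in one ball, so a single compact set contains
  -- all the values of `G` that are used.
  have hball : ∀ n, ∀ r ∈ Set.Icc (0 : ℝ) 1, stepFun n (a n) r ∈ Metric.closedBall x P := by
    intro n r hr
    rw [mem_closedBall_iff_norm, hnode, ← hY0 n]
    refine (hYlip _ _ _).trans ?_
    have h1 := (mem_Ico_floor n hr.1).1.trans hr.2
    rw [sub_zero, abs_of_nonneg (by positivity)]
    exact mul_le_of_le_one_right (by positivity) h1
  -- compactness of the parts `Z n`
  obtain ⟨C, hC, hGC⟩ := hGc x P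
  set S : Set E := closedAbsConvexHull ℝ C with hS
  have hScomp : IsCompact S := isCompact_closedAbsConvexHull_of_totallyBounded hC.totallyBounded
  have hZS : ∀ n, ∀ u ∈ Set.Icc (0 : ℝ) 1, Z n u ∈ S := fun n u hu =>
    integral_stepFun_mem (haG n) absConvex_convexClosedHull isClosed_closedAbsConvexHull
      (fun r hr => subset_closedAbsConvexHull (hGC (hball n r hr))) hu
  have hZl : ∀ n, LipschitzWith ⟨M, hM⟩ fun u : Set.Icc (0 : ℝ) 1 => Z n u := fun n =>
    LipschitzWith.of_dist_le_mul fun u v => by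
      rw [dist_eq_norm]
      exact hZlip n u v
  set z : ℕ → BoundedContinuousFunction (Set.Icc (0 : ℝ) 1) E := fun n =>
    BoundedContinuousFunction.mkOfCompact ⟨fun u => Z n u, (hZl n).continuous⟩ with hz
  have hcomp : IsCompact (closure (Set.range z)) := by
    refine BoundedContinuousFunction.arzela_ascoli S hScomp _ ?_ ?_
    · rintro _ u ⟨n, rfl⟩
      exact hZS n u u.2
    · refine (LipschitzWith.uniformEquicontinuous _ ⟨M, hM⟩ ?_).equicontinuous
      rintro ⟨_, n, rfl⟩
      exact hZl n
  obtain ⟨ζ, -, φ, hφ, hlim⟩ := hcomp.tendsto_subseq fun n => subset_closure ⟨n, rfl⟩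
  set ε : ℕ → ℝ := fun n => κ * (P / (n + 1) + dist (z n) ζ) with hε
  have hεlim : Tendsto (fun n => ε (φ n)) atTop (𝓝 0) := by
    have h1 : Tendsto (fun n => P / ((φ n : ℝ) + 1)) atTop (𝓝 0) := by
      have := (tendsto_one_div_add_atTop_nhds_zero_nat (𝕜 := ℝ)).const_mul P
      rw [mul_zero] at this
      refine (this.comp hφ.tendsto_atTop).congr fun n => ?_
      simp [div_eq_mul_inv]
    have h2 : Tendsto (fun n => dist (z (φ n)) ζ) atTop (𝓝 0) := tendsto_iff_dist_tendsto_zero.1 hlim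
    simpa using (h1.add h2).const_mul (κ : ℝ)
  -- Gronwall's inequality for the parts `U n`
  have hUd : ∀ n, ∀ t ∈ Set.Ico (0 : ℝ) 1,
      HasDerivWithinAt (U n) (A (stepFun n (a n) t)) (Set.Ici t) t := fun n t ht =>
    (hasDerivWithinAt_integral_stepFun (haA n) ht.1).const_add x
  have hUc : ∀ n, ContinuousOn (U n) (Set.Icc 0 1) := by
    intro n
    refine LipschitzWith.continuous (K := ⟨M, hM⟩) (LipschitzWith.of_dist_le_mul fun u v => ?_)
      |>.continuousOn
    rw [dist_eq_norm]
    simp only [hU]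
    rw [add_sub_add_left_eq_sub]
    exact norm_integral_stepFun_sub_le (haA n) u v
  -- The defect has two sources: the lag between a polygon and its last node, and the distance of `Z
  -- n` to `ζ`. The projection extends `ζ` to all times, as the Gronwall lemma requires a field on
  -- `ℝ`.
  have hUapp : ∀ n, ∀ t ∈ Set.Ico (0 : ℝ) 1, dist (A (stepFun n (a n) t))
      (A (U n t + ζ (Set.projIcc 0 1 zero_le_one t))) ≤ ε n := by
    intro n t ht
    refine (hA.dist_le_mul _ _).trans (mul_le_mul_of_nonneg_left ?_ κ.2)
    have ht' : t ∈ Set.Icc (0 : ℝ) 1 := ⟨ht.1, ht.2.le⟩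
    have h1 : dist (Z n t) (ζ (Set.projIcc 0 1 zero_le_one t)) ≤ dist (z n) ζ := by
      rw [Set.projIcc_of_mem zero_le_one ht']
      exact BoundedContinuousFunction.dist_coe_le_dist (f := z n) (g := ζ) ⟨t, ht'⟩
    have h2 := hclose n t ht.1
    rw [← dist_eq_norm] at h2
    refine (dist_triangle _ (Y n t) _).trans (add_le_add h2 ?_)
    rw [hYUZ, dist_add_left]
    exact h1
  have hUdist : ∀ m n, ∀ t ∈ Set.Icc (0 : ℝ) 1,
      dist (U m t) (U n t) ≤ (ε m + ε n) * gronwallBound 0 κ 1 t := by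
    intro m n t ht
    have := dist_le_of_approx_trajectories_ODE (δ := 0) (K := κ)
      (v := fun t w => A (w + ζ (Set.projIcc 0 1 zero_le_one t)))
      (fun t => by
        refine LipschitzWith.of_dist_le_mul fun v w => ?_
        simpa using hA.dist_le_mul (v + ζ (Set.projIcc 0 1 zero_le_one t))
          (w + ζ (Set.projIcc 0 1 zero_le_one t)))
      (hUc m) (hUd m) (hUapp m) (hUc n) (hUd n) (hUapp n) (by simp [hU]) t ht
    rwa [gronwallBound_zero_eq, sub_zero] at this
  have hYlim : ∀ t ∈ Set.Icc (0 : ℝ) 1, ∃ l, Tendsto (fun n => Y (φ n) t) atTop (𝓝 l) := by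
    intro t ht
    have h1 : CauchySeq fun n => U (φ n) t := by
      rw [cauchySeq_iff_tendsto_dist_atTop_0]
      have h2 : Tendsto (fun n : ℕ × ℕ => (ε (φ n.1) + ε (φ n.2)) * gronwallBound 0 κ 1 t) atTop
          (𝓝 0) := by
        have := ((hεlim.comp (tendsto_fst (f := atTop) (g := atTop))).add
          (hεlim.comp (tendsto_snd (f := atTop) (g := atTop)))).mul_const
            (gronwallBound 0 κ 1 t)
        rw [prod_atTop_atTop_eq] at this
        simpa using this
      exact squeeze_zero (fun _ => dist_nonneg) (fun n => hUdist _ _ t ht) h2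
    obtain ⟨l, hl⟩ := cauchySeq_tendsto_of_complete h1
    have h2 : Tendsto (fun n => Z (φ n) t) atTop (𝓝 (ζ ⟨t, ht⟩)) := by
      refine tendsto_iff_dist_tendsto_zero.2 (squeeze_zero (fun _ => dist_nonneg) (fun n => ?_)
        (tendsto_iff_dist_tendsto_zero.1 hlim))
      exact BoundedContinuousFunction.dist_coe_le_dist (f := z (φ n)) (g := ζ) ⟨t, ht⟩
    exact ⟨_, (hl.add h2).congr fun n => (hYUZ _ _).symm⟩
  choose! y hy using hYlim
  -- the limit is a solution
  have hylip : ∀ u ∈ Set.Icc (0 : ℝ) 1, ∀ v ∈ Set.Icc (0 : ℝ) 1, ‖y u - y v‖ ≤ P * |u - v| :=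
    fun u hu v hv => le_of_tendsto ((hy u hu).sub (hy v hv)).norm
      (Eventually.of_forall fun n => hYlip _ u v)
  have hbY : ∀ r ∈ Set.Icc (0 : ℝ) 1, Tendsto (fun n => stepFun (φ n) (a (φ n)) r) atTop
      (𝓝 (y r)) := by
    intro r hr
    have h1 : Tendsto (fun n => P / ((φ n : ℝ) + 1)) atTop (𝓝 0) := by
      have := (tendsto_one_div_add_atTop_nhds_zero_nat (𝕜 := ℝ)).const_mul P
      rw [mul_zero] at this
      refine (this.comp hφ.tendsto_atTop).congr fun n => ?_
      simp [div_eq_mul_inv]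
    have h2 := squeeze_zero_norm (fun n => hclose (φ n) r hr.1) h1
    simpa using h2.add (hy r hr)
  have hint : ∀ u ∈ Set.Icc (0 : ℝ) 1, y u = x + ∫ r in (0 : ℝ)..u, F (y r) := by
    intro u hu
    refine tendsto_nhds_unique (hy u hu) (Tendsto.const_add x ?_)
    refine intervalIntegral.tendsto_integral_filter_of_dominated_convergence (fun _ => P)
      (Eventually.of_forall fun n => (stronglyMeasurable_stepFun _ _).aestronglyMeasurable)
      (Eventually.of_forall fun n => Eventually.of_forall fun r _ => haF _ _)
      intervalIntegrable_const (Eventually.of_forall fun r hr => ?_)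
    rw [Set.uIoc_of_le hu.1] at hr
    exact (hFc.tendsto _).comp (hbY r ⟨hr.1.le, hr.2.trans hu.2⟩)
  -- Freezing `y` outside `[0,1]` gives an integrand continuous on `ℝ`, to which the fundamental
  -- theorem of calculus applies, endpoints included.
  have hycont : Continuous fun r : ℝ => y (Set.projIcc (0 : ℝ) 1 zero_le_one r) := by
    have h1 : Continuous fun r : Set.Icc (0 : ℝ) 1 => y r :=
      (LipschitzWith.of_dist_le_mul (K := ⟨P, by positivity⟩) fun u v => by
        rw [dist_eq_norm]
        exact hylip u u.2 v v.2).continuous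
    exact h1.comp continuous_projIcc
  have hgc : Continuous fun r : ℝ => F (y (Set.projIcc (0 : ℝ) 1 zero_le_one r)) := hFc.comp hycont
  have heq : ∀ u ∈ Set.Icc (0 : ℝ) 1,
      y u = x + ∫ r in (0 : ℝ)..u, F (y (Set.projIcc (0 : ℝ) 1 zero_le_one r)) := by
    intro u hu
    rw [hint u hu]
    congr 1
    refine intervalIntegral.integral_congr fun r hr => ?_
    rw [Set.uIcc_of_le hu.1] at hr
    rw [Set.projIcc_of_mem zero_le_one ⟨hr.1, hr.2.trans hu.2⟩]
  refine ⟨y, by rw [heq 0 ⟨le_rfl, zero_le_one⟩]; simp, fun u hu => ?_⟩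
  have hd := ((hgc.integral_hasStrictDerivAt 0 u).hasDerivAt.const_add x).hasDerivWithinAt
    (s := Set.Icc (0 : ℝ) 1)
  rw [Set.projIcc_of_mem zero_le_one hu] at hd
  exact hd.congr heq (heq u hu)

end Peano

/-! ### Taylor expansion along the log-ODE -/

section Taylor

variable {ℓ N : ℕ}

/-- The products are regrouped by their right factor `v`. A word `v` of length `N` could only be
preceded by the empty word, where `L` vanishes; hence only `|v| < N` occurs, matching the range of
the differential system. -/
theorem sum_coord_mul_eq (L b : TruncTensor ℓ N) (hL : L.coord [] = 0) (φ : List (Fin ℓ) → ℝ) :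
    ∑ q ∈ Finset.range (N + 1), ∑ w ∈ words ℓ q, (L * b).coord w * φ w
      = ∑ m ∈ Finset.range N, ∑ v ∈ words ℓ m, b.coord v *
          ∑ k ∈ Finset.range (N - m + 1), ∑ u ∈ words ℓ k, L.coord u * φ (u ++ v) := by
  set S : ℕ → ℕ → ℝ := fun k m =>
    ∑ u ∈ words ℓ k, ∑ v ∈ words ℓ m, L.coord u * b.coord v * φ (u ++ v) with hS
  have h1 : ∀ q ∈ Finset.range (N + 1), ∑ w ∈ words ℓ q, (L * b).coord w * φ w
      = ∑ k ∈ Finset.range (q + 1), S k (q - k) := fun q hq =>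
    sum_coord_mul_smul L b (by simpa [Nat.lt_succ_iff] using hq) φ
  rw [Finset.sum_congr rfl h1, Finset.sum_range_diag_flip,
    Finset.sum_comm' (t' := Finset.range (N + 1)) (s' := fun m => Finset.range (N + 1 - m))
      (by intro x y; simp only [Finset.mem_range]; omega), Finset.sum_range_succ]
  have h0 : ∑ k ∈ Finset.range (N + 1 - N), S k N = 0 := by
    simp [hS, sum_words_zero, hL]
  rw [h0, add_zero]
  refine Finset.sum_congr rfl fun m hm => ?_
  rw [Finset.mem_range] at hm
  rw [show N + 1 - m = N - m + 1 by omega]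
  simp only [hS, Finset.mul_sum]
  conv_rhs => rw [Finset.sum_comm]
  refine Finset.sum_congr rfl fun k _ => ?_
  rw [Finset.sum_comm]
  refine Finset.sum_congr rfl fun v _ => Finset.sum_congr rfl fun u _ => ?_
  ring

/-- If the functions `φ_M` solve the triangular system of the flow of `L` up to remainders
`r_M`, then `φ_∅(1)` is given by the coordinates of `exp L`, up to the accumulated remainders. -/
theorem abs_sub_sum_coord_texp_le (hN : 1 ≤ N) {L : TruncTensor ℓ N} (hL : L.coord [] = 0)
    {φ r : List (Fin ℓ) → ℝ → ℝ}
    (hφ : ∀ M : List (Fin ℓ), M.length < N → ∀ u ∈ Set.Icc (0 : ℝ) 1,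
      HasDerivWithinAt (φ M) (∑ k ∈ Finset.range (N - M.length + 1), ∑ K ∈ words ℓ k,
        L.coord K * φ (K ++ M) u + r M u) (Set.Icc 0 1) u) {β D : ℝ}
    (hD : ∀ u ∈ Set.Ico (0 : ℝ) 1,
      |∑ Q ∈ words ℓ N, (L * texp ((1 - u) • L)).coord Q * (φ Q u - φ Q 0)
        + ∑ m ∈ Finset.range N, ∑ M ∈ words ℓ m, (texp ((1 - u) • L)).coord M * r M u - β| ≤ D) :
    |φ [] 1 - ∑ m ∈ Finset.range (N + 1), ∑ M ∈ words ℓ m, (texp L).coord M * φ M 0 - β| ≤ D := by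
  set E : ℝ → TruncTensor ℓ N := fun u => texp ((1 - u) • L) with hE
  -- This interpolates between the full expansion at `u = 0` and `φ [] 1 - β` at `u = 1`. The words
  -- of length `N` are frozen at time `0`, as their `φ` need not be differentiable; `β` will be the
  -- first-order drift.
  set Ψ : ℝ → ℝ := fun u => ∑ m ∈ Finset.range N, ∑ M ∈ words ℓ m, (E u).coord M * φ M u
    + ∑ M ∈ words ℓ N, (E u).coord M * φ M 0 - u * β with hΨ
  have hEd : ∀ (w : List (Fin ℓ)) (u : ℝ),
      HasDerivAt (fun u => (E u).coord w) (-(L * E u).coord w) u := by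
    intro w u
    have h := (hasDerivAt_coord_texp_smul hL w (1 - u)).comp u ((hasDerivAt_id u).const_sub 1)
    rw [mul_neg_one] at h
    exact h
  have hd : ∀ u ∈ Set.Icc (0 : ℝ) 1, HasDerivWithinAt Ψ
      (∑ Q ∈ words ℓ N, (L * E u).coord Q * (φ Q u - φ Q 0)
        + ∑ m ∈ Finset.range N, ∑ M ∈ words ℓ m, (E u).coord M * r M u - β)
      (Set.Icc 0 1) u := by
    intro u hu
    have h1 : HasDerivWithinAt Ψ
        (∑ m ∈ Finset.range N, ∑ M ∈ words ℓ m, (-(L * E u).coord M * φ M u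
          + (E u).coord M * (∑ k ∈ Finset.range (N - m + 1), ∑ K ∈ words ℓ k,
              L.coord K * φ (K ++ M) u + r M u))
          + ∑ M ∈ words ℓ N, -(L * E u).coord M * φ M 0 - 1 * β) (Set.Icc 0 1) u := by
      refine ((HasDerivWithinAt.fun_sum fun m hm => HasDerivWithinAt.fun_sum fun M hM => ?_).add
        (HasDerivWithinAt.fun_sum fun M _ => ?_)).sub ((hasDerivWithinAt_id u _).mul_const β)
      · rw [mem_words] at hM
        subst hM
        exact (hEd M u).hasDerivWithinAt.mul (hφ M (Finset.mem_range.1 hm) u hu)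
      · exact (hEd M u).hasDerivWithinAt.mul_const _
    convert h1 using 1
    have h2 := sum_coord_mul_eq L (E u) hL fun w => φ w u
    rw [Finset.sum_range_succ] at h2
    simp only [mul_add, mul_sub, neg_mul, Finset.sum_add_distrib, Finset.sum_sub_distrib,
      Finset.sum_neg_distrib]
    linarith
  have h1 : Ψ 1 = φ [] 1 - β := by
    have hE1 : E 1 = 1 := by
      refine ext_coord fun w hw => ?_
      simp only [hE, sub_self]
      rw [coord_texp_smul, Finset.sum_eq_single 0]
      · simp
      · intro n _ hn
        simp [hn]
      · simp
    have hz : ∀ m, m ≠ 0 → ∀ ψ : List (Fin ℓ) → ℝ,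
        ∑ M ∈ words ℓ m, (1 : TruncTensor ℓ N).coord M * ψ M = 0 := by
      intro m hm ψ
      refine Finset.sum_eq_zero fun M hM => ?_
      rw [mem_words] at hM
      rw [coord_one, if_neg, zero_mul]
      rintro rfl
      exact hm hM.symm
    simp only [hΨ, hE1]
    rw [hz N (by omega) fun M => φ M 0, Finset.sum_eq_single 0, sum_words_zero, coord_one]
    · simp
    · intro m _ hm
      exact hz m hm fun M => φ M 1
    · intro h
      exact absurd (Finset.mem_range.2 hN) h
  have h0 : Ψ 0 = ∑ m ∈ Finset.range (N + 1), ∑ M ∈ words ℓ m, (texp L).coord M * φ M 0 := by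
    simp only [hΨ, hE]
    rw [Finset.sum_range_succ]
    simp
  have := norm_image_sub_le_of_norm_deriv_le_segment_01' hd hD
  rw [h1, h0, Real.norm_eq_abs] at this
  rwa [sub_right_comm] at this

end Taylor

/-! ### The local error estimate -/

section LocalError

variable {E : Type*} [NormedAddCommGroup E] [NormedSpace ℝ E]
  {F : Type*} [NormedAddCommGroup F] [NormedSpace ℝ F] {ℓ N : ℕ}

/-- A uniform bound for the norms of the operators `V_I`, `|I| ≤ n + 1`. -/
noncomputable def wordConst (n : ℕ) (K : ℝ) : ℝ := (2 ^ (n + 1) * K + 1) ^ (n + 1)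

theorem one_le_wordConst {n : ℕ} {K : ℝ} (hK : 0 ≤ K) : 1 ≤ wordConst n K :=
  one_le_pow₀ (by nlinarith [pow_pos (two_pos (α := ℝ)) (n + 1)])

theorem holderBound_wordDerivMap {W : Fin ℓ → E → E} {g : E → F} {n : ℕ} {α B K : ℝ}
    (hB : 0 ≤ B) (hK : 0 ≤ K) (hW : ∀ i, HolderBound n α K (W i)) (I : List (Fin ℓ)) {m : ℕ}
    (hm : m + I.length ≤ n + 1) (hg : HolderBound (m + I.length) α B g) :
    HolderBound m α (wordConst n K * B) (wordDerivMap W I g) := by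
  refine (HolderBound.wordDerivMap hB hK hW I hm hg).mono
    (mul_le_mul_of_nonneg_right ?_ hB)
  have h0 : 0 ≤ 2 ^ (n + 1) * K := by positivity
  calc (2 ^ (n + 1) * K) ^ I.length ≤ (2 ^ (n + 1) * K + 1) ^ I.length := by
        gcongr
        linarith
    _ ≤ _ := pow_le_pow_right₀ (by linarith) (by omega)

/-- The identity is unbounded, so the last letter is first absorbed into it: `V_{Ji} id = V_J W_i`,
and `W_i` is bounded with its derivatives. -/
theorem norm_wordDerivMap_id_le {W : Fin ℓ → E → E} {n : ℕ} {α K : ℝ}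
    (hK : 0 ≤ K) (hW : ∀ i, HolderBound n α K (W i)) {I : List (Fin ℓ)} (hI : I ≠ [])
    (hIn : I.length ≤ n + 1) (x : E) :
    ‖wordDerivMap W I id x‖ ≤ wordConst n K * K := by
  obtain ⟨J, i, rfl⟩ : ∃ J i, I = J ++ [i] := ⟨_, _, (List.dropLast_append_getLast hI).symm⟩
  rw [List.length_append, List.length_singleton] at hIn
  have hi : wordDerivMap W [i] (id : E → E) = W i := by
    funext y
    simp [wordDerivMap]
  rw [wordDerivMap_append, hi]
  exact (holderBound_wordDerivMap hK hK hW J (m := 0) (by omega)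
    ((hW i).of_le (by omega))).norm_le x

/-- A uniform bound for the numbers of words of length at most `N`. -/
noncomputable def wordCount (ℓ N : ℕ) : ℝ := ∑ k ∈ Finset.range (N + 1), ((words ℓ k).card : ℝ)

theorem card_words_le {k : ℕ} (hk : k ≤ N) : ((words ℓ k).card : ℝ) ≤ wordCount ℓ N :=
  Finset.single_le_sum (f := fun k => ((words ℓ k).card : ℝ)) (fun _ _ => Nat.cast_nonneg _)
    (Finset.mem_range.2 (by omega))

theorem wordCount_nonneg : 0 ≤ wordCount ℓ N := Finset.sum_nonneg fun _ _ => Nat.cast_nonneg _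

theorem norm_sum_words_le {G : Type*} [SeminormedAddCommGroup G] {k : ℕ} (hk : k ≤ N)
    {a : List (Fin ℓ) → G} {c : ℝ} (hc : 0 ≤ c) (h : ∀ w ∈ words ℓ k, ‖a w‖ ≤ c) :
    ‖∑ w ∈ words ℓ k, a w‖ ≤ wordCount ℓ N * c := by
  refine (norm_sum_le_of_le _ h).trans ?_
  rw [Finset.sum_const, nsmul_eq_mul]
  exact mul_le_mul_of_nonneg_right (card_words_le hk) hc

theorem norm_levelField_le {W : Fin ℓ → E → E} {n : ℕ} {α K C ρ : ℝ} (hK : 0 ≤ K)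
    (hC : 0 ≤ C) (hρ : 0 ≤ ρ) (hW : ∀ i, HolderBound n α K (W i)) {Λ : List (Fin ℓ) → ℝ}
    (hΛ : HomBound N C ρ (lieElement N Λ)) {k : ℕ} (hk1 : 1 ≤ k) (hkN : k ≤ N)
    (hkn : k ≤ n + 1) (x : E) :
    ‖levelField W Λ k x‖ ≤ wordCount ℓ N * (C * (wordConst n K * K)) * ρ ^ k := by
  have hQ := one_le_wordConst (n := n) hK
  rw [levelField_eq (fun i => (hW i).contDiff) Λ hk1 hkn hkN, mul_assoc]
  refine norm_sum_words_le hkN (by positivity) fun w hw => ?_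
  rw [mem_words] at hw
  have h1 := hΛ w (by omega)
  have hne : w ≠ [] := by rintro rfl; simp at hw; omega
  have h2 := norm_wordDerivMap_id_le hK hW hne (by omega) x
  rw [norm_smul, Real.norm_eq_abs]
  rw [hw] at h1
  calc _ ≤ (C * ρ ^ k) * (wordConst n K * K) := by gcongr
    _ = _ := by ring

theorem norm_logODEField_le {W : Fin ℓ → E → E} {V : E → E} {n : ℕ} {α K C ρ h : ℝ}
    (hK : 0 ≤ K) (hC : 0 ≤ C) (hρ : 0 ≤ ρ) (hρ1 : ρ ≤ 1) (hh0 : 0 ≤ h) (hh : h ≤ ρ)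
    (hV : ∀ x, ‖V x‖ ≤ K) (hW : ∀ i, HolderBound n α K (W i)) {Λ : List (Fin ℓ) → ℝ}
    (hΛ : HomBound N C ρ (lieElement N Λ)) (hNn : N ≤ n + 1) (x : E) :
    ‖logODEField N V W h Λ x‖ ≤ (K + N * (wordCount ℓ N * (C * (wordConst n K * K)))) * ρ := by
  have hQ := one_le_wordConst (n := n) hK
  have hc := wordCount_nonneg (ℓ := ℓ) (N := N)
  rw [logODEField_eq]
  have h1 : ‖h • V x‖ ≤ K * ρ := by
    rw [norm_smul, Real.norm_of_nonneg hh0, mul_comm]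
    have := hV x
    gcongr
  have h2 : ‖∑ k ∈ Finset.Icc 1 N, levelField W Λ k x‖
      ≤ ∑ k ∈ Finset.Icc 1 N, wordCount ℓ N * (C * (wordConst n K * K)) * ρ := by
    refine norm_sum_le_of_le _ fun k hk => ?_
    rw [Finset.mem_Icc] at hk
    refine (norm_levelField_le hK hC hρ hW hΛ hk.1 hk.2 (by omega) x).trans ?_
    gcongr
    exact pow_le_of_le_one hρ hρ1 (by omega)
  rw [Finset.sum_const, Nat.card_Icc, Nat.add_sub_cancel, nsmul_eq_mul] at h2
  refine (norm_add_le _ _).trans ((add_le_add h1 h2).trans (le_of_eq ?_))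
  ring

/-- The derivative of `V_M f` along the log-ODE field, up to terms of high order. -/
theorem abs_fderiv_logODEField_sub_le {W : Fin ℓ → E → E} {V : E → E} {n : ℕ}
    {α K C ρ h B : ℝ} (hK : 0 ≤ K) (hC : 0 ≤ C) (hρ : 0 ≤ ρ) (hρ1 : ρ ≤ 1) (hB : 0 ≤ B)
    (hW : ∀ i, HolderBound n α K (W i)) {Λ : List (Fin ℓ) → ℝ}
    (hΛ : HomBound N C ρ (lieElement N Λ)) (hNn : N = n + 1) {f : E → ℝ}
    (hf : HolderBound N α B f) {M : List (Fin ℓ)} (hM : M.length < N) (x : E) :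
    |fderiv ℝ (wordDerivMap W M f) x (logODEField N V W h Λ x)
        - ∑ k ∈ Finset.range (N - M.length + 1), ∑ w ∈ words ℓ k,
          (lieElement N Λ).coord w * wordDerivMap W (w ++ M) f x
        - h * fderiv ℝ (wordDerivMap W M f) x (V x)|
      ≤ N * (wordConst n K * (wordCount ℓ N * (C * (wordConst n K * K)))) * B
          * ρ ^ (N + 1 - M.length) := by
  have hQ := one_le_wordConst (n := n) hK
  have hc := wordCount_nonneg (ℓ := ℓ) (N := N)
  set g := wordDerivMap W M f with hg
  have hgb : HolderBound (N - M.length) α (wordConst n K * B) g :=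
    holderBound_wordDerivMap hB hK hW M (by omega) (hf.of_le (by omega))
  have hDg := hgb.norm_fderiv_le (by omega) x
  have hlow : ∑ k ∈ Finset.range (N - M.length + 1), ∑ w ∈ words ℓ k,
      (lieElement N Λ).coord w * wordDerivMap W (w ++ M) f x
      = ∑ k ∈ Finset.Icc 1 (N - M.length), fderiv ℝ g x (levelField W Λ k x) := by
    have hins : Finset.range (N - M.length + 1) = insert 0 (Finset.Icc 1 (N - M.length)) := by
      ext k
      simp only [Finset.mem_range, Finset.mem_insert, Finset.mem_Icc]
      omega
    rw [hins, Finset.sum_insert (by simp), sum_words_zero, coord_lieElement_nil, zero_mul,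
      zero_add]
    refine Finset.sum_congr rfl fun k hk => ?_
    rw [Finset.mem_Icc] at hk
    have hgk : ContDiff ℝ (k : ℕ) g :=
      hgb.contDiff.of_le (by exact_mod_cast hk.2)
    rw [fderiv_apply_levelField (N := N) (fun i => (hW i).contDiff) Λ hk.1 (by omega) (by omega)
      hgk]
    simp only [hg, wordDerivMap_append, smul_eq_mul]
  have hsplit : ∑ k ∈ Finset.Icc 1 N, fderiv ℝ g x (levelField W Λ k x)
      = ∑ k ∈ Finset.Icc 1 (N - M.length), fderiv ℝ g x (levelField W Λ k x)
        + ∑ k ∈ Finset.Icc (N - M.length + 1) N, fderiv ℝ g x (levelField W Λ k x) := by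
    rw [← Finset.sum_union]
    · congr 1
      ext k
      simp only [Finset.mem_union, Finset.mem_Icc]
      omega
    · rw [Finset.disjoint_left]
      intro k h1 h2
      rw [Finset.mem_Icc] at h1 h2
      omega
  have hmain : fderiv ℝ g x (logODEField N V W h Λ x)
        - ∑ k ∈ Finset.range (N - M.length + 1), ∑ w ∈ words ℓ k,
          (lieElement N Λ).coord w * wordDerivMap W (w ++ M) f x
        - h * fderiv ℝ g x (V x)
      = ∑ k ∈ Finset.Icc (N - M.length + 1) N, fderiv ℝ g x (levelField W Λ k x) := by
    rw [logODEField_eq, map_add, map_smul, map_sum, hsplit, hlow, smul_eq_mul]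
    ring
  rw [hmain, ← Real.norm_eq_abs]
  -- At these levels `V_M f` may lack the derivatives needed to expand the brackets, but the size `ρ
  -- ^ k` of the field already suffices.
  have hterm : ∀ k ∈ Finset.Icc (N - M.length + 1) N, ‖fderiv ℝ g x (levelField W Λ k x)‖
      ≤ wordConst n K * (wordCount ℓ N * (C * (wordConst n K * K))) * B
        * ρ ^ (N + 1 - M.length) := by
    intro k hk
    rw [Finset.mem_Icc] at hk
    have h1 := norm_levelField_le hK hC hρ hW hΛ (k := k) (by omega) hk.2 (by omega) x
    have h2 : ρ ^ k ≤ ρ ^ (N + 1 - M.length) := pow_le_pow_of_le_one hρ hρ1 (by omega)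
    calc _ ≤ ‖fderiv ℝ g x‖ * ‖levelField W Λ k x‖ := ContinuousLinearMap.le_opNorm _ _
      _ ≤ (wordConst n K * B) * (wordCount ℓ N * (C * (wordConst n K * K))
            * ρ ^ (N + 1 - M.length)) := by
          refine mul_le_mul hDg (h1.trans ?_) (norm_nonneg _) (by positivity)
          gcongr
      _ = _ := by ring
  refine (norm_sum_le_of_le _ hterm).trans ?_
  rw [Finset.sum_const, Nat.card_Icc, nsmul_eq_mul]
  have h3 : ((N + 1 - (N - M.length + 1) : ℕ) : ℝ) ≤ N := by exact_mod_cast (by omega)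
  calc _ ≤ (N : ℝ) * (wordConst n K * (wordCount ℓ N * (C * (wordConst n K * K))) * B
        * ρ ^ (N + 1 - M.length)) := by gcongr
    _ = _ := by ring

/-- The error of the Taylor expansion of a `γ`-Lipschitz function along the log-ODE. -/
theorem exists_taylor_const (ℓ N : ℕ) {n : ℕ} (hNn : N = n + 1) (hn : 1 ≤ n) {K α p γ : ℝ}
    (hK : 0 ≤ K) (hα : 0 ≤ α) (hp : 1 ≤ p) (hγ : γ = N + α) (hα1 : α ≤ 1) (hγp : γ ≤ p + 1) :
    ∃ c : ℝ, 0 ≤ c ∧ ∀ {V : E → E} {W : Fin ℓ → E → E} {Λ : List (Fin ℓ) → ℝ} {ρ h B : ℝ}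
      {f : E → ℝ} {y : ℝ → E}, (∀ x, ‖V x‖ ≤ K) → (∀ x y, ‖V x - V y‖ ≤ K * ‖x - y‖) →
      (∀ i, HolderBound n α K (W i)) → 0 ≤ B → HolderBound N α B f → 0 ≤ ρ → ρ ≤ 1 → 0 ≤ h →
      h ≤ ρ ^ p → HomBound N 1 ρ (texp (lieElement N Λ)) →
      (∀ u ∈ Set.Icc (0 : ℝ) 1,
        HasDerivWithinAt y (logODEField N V W h Λ (y u)) (Set.Icc 0 1) u) →
      |f (y 1) - ∑ m ∈ Finset.range (N + 1), ∑ M ∈ words ℓ m,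
          (texp (lieElement N Λ)).coord M * wordDerivMap W M f (y 0)
        - h * fderiv ℝ f (y 0) (V (y 0))| ≤ c * B * ρ ^ γ := by
  obtain ⟨C, hC1, hC⟩ := exists_homBound N
  have hC0 : 0 ≤ C := by linarith
  set Q := wordConst n K with hQdef
  have hQ1 : 1 ≤ Q := one_le_wordConst hK
  set w := wordCount ℓ N with hw
  have hw0 : 0 ≤ w := wordCount_nonneg
  set C₃ := w * (C * (Q * K)) with hC3
  have hC30 : 0 ≤ C₃ := by positivity
  set C₄ := K + N * C₃ with hC4
  have hC40 : 0 ≤ C₄ := by positivity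
  set C₅ := N * (Q * C₃) with hC5
  have hC50 : 0 ≤ C₅ := by positivity
  -- The first summand comes from the increments of `V_Q f`, `|Q| = N`; then `C₅ + 2 * K * C₄` from
  -- the empty word; the last one from the words of length `1` to `n`.
  refine ⟨w * (C * (Q * C₄ ^ α)) + (C₅ + 2 * K * C₄ + n * (w * (C * (Q * K + C₅)))), by positivity,
    ?_⟩
  intro V W Λ ρ h B f y hV hVl hW hB hf hρ hρ1 hh0 hh hexp hy
  set L := lieElement N Λ with hL
  have hL0 : L.coord [] = 0 := coord_lieElement_nil Λ
  obtain ⟨hLb, hEb⟩ := hC L ρ hρ hL0 hexp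
  have hρp : ρ ^ p ≤ ρ := by
    rcases hρ.eq_or_lt with h0 | h0
    · rw [← h0, Real.zero_rpow (by linarith)]
    · simpa using Real.rpow_le_rpow_of_exponent_ge h0 hρ1 hp
  have hhρ : h ≤ ρ := hh.trans hρp
  -- powers of `ρ`
  have hγ0 : 0 < γ := by
    rw [hγ, hNn]
    positivity
  have hpowN : ρ ^ (N + 1) ≤ ρ ^ γ := by
    rcases hρ.eq_or_lt with h0 | h0
    · rw [← h0, Real.zero_rpow hγ0.ne', zero_pow (by omega)]
    · rw [← Real.rpow_natCast]
      refine Real.rpow_le_rpow_of_exponent_ge h0 hρ1 ?_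
      push_cast
      linarith
  have hpowh : h * ρ ≤ ρ ^ γ := by
    rcases hρ.eq_or_lt with h0 | h0
    · rw [← h0, Real.zero_rpow hγ0.ne', mul_zero]
    · calc h * ρ ≤ ρ ^ p * ρ := by gcongr
        _ = ρ ^ (p + 1) := by rw [Real.rpow_add h0, Real.rpow_one]
        _ ≤ ρ ^ γ := Real.rpow_le_rpow_of_exponent_ge h0 hρ1 hγp
  have hpowα : ρ ^ N * ρ ^ α = ρ ^ γ := by
    rcases hρ.eq_or_lt with h0 | h0
    · rw [← h0, Real.zero_rpow hγ0.ne', zero_pow (by omega), zero_mul]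
    · rw [hγ, Real.rpow_add h0, Real.rpow_natCast]
  have hργ : 0 ≤ ρ ^ γ := by positivity
  -- the solution moves by at most `C₄ ρ`
  have hmove : ∀ u ∈ Set.Icc (0 : ℝ) 1, ‖y u - y 0‖ ≤ C₄ * ρ := by
    intro u hu
    have := Convex.norm_image_sub_le_of_norm_hasDerivWithin_le hy
      (fun u _ => norm_logODEField_le hK hC0 hρ hρ1 hh0 hhρ hV hW hLb hNn.le (y u))
      (convex_Icc 0 1) (Set.left_mem_Icc.2 zero_le_one) hu
    refine this.trans (mul_le_of_le_one_right (by positivity) ?_)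
    rw [sub_zero, Real.norm_of_nonneg hu.1]
    exact hu.2
  -- the triangular system
  set φ : List (Fin ℓ) → ℝ → ℝ := fun M u => wordDerivMap W M f (y u) with hφ
  set r : List (Fin ℓ) → ℝ → ℝ := fun M u =>
    fderiv ℝ (wordDerivMap W M f) (y u) (logODEField N V W h Λ (y u))
      - ∑ k ∈ Finset.range (N - M.length + 1), ∑ w ∈ words ℓ k, L.coord w * φ (w ++ M) u with hr
  have hφd : ∀ M : List (Fin ℓ), M.length < N → ∀ u ∈ Set.Icc (0 : ℝ) 1,
      HasDerivWithinAt (φ M) (∑ k ∈ Finset.range (N - M.length + 1), ∑ K ∈ words ℓ k,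
        L.coord K * φ (K ++ M) u + r M u) (Set.Icc 0 1) u := by
    intro M hM u hu
    have hg : HolderBound (N - M.length) α (Q * B) (wordDerivMap W M f) :=
      holderBound_wordDerivMap hB hK hW M (by omega) (hf.of_le (by omega))
    have hdiff : DifferentiableAt ℝ (wordDerivMap W M f) (y u) :=
      (hg.of_le (by omega : 1 ≤ N - M.length)).contDiff.differentiable (by norm_num) _
    refine (hdiff.hasFDerivAt.comp_hasDerivWithinAt u (hy u hu)).congr_deriv ?_
    exact (add_sub_cancel (∑ k ∈ Finset.range (N - M.length + 1), ∑ K ∈ words ℓ k,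
      L.coord K * φ (K ++ M) u) _).symm
  have hrb : ∀ M : List (Fin ℓ), M.length < N → ∀ u,
      |r M u - h * fderiv ℝ (wordDerivMap W M f) (y u) (V (y u))|
        ≤ C₅ * B * ρ ^ (N + 1 - M.length) := fun M hM u =>
    abs_fderiv_logODEField_sub_le hK hC0 hρ hρ1 hB hW hLb hNn hf hM (y u)
  -- the three contributions to the remainder
  have hT1 : ∀ u ∈ Set.Icc (0 : ℝ) 1,
      |∑ M ∈ words ℓ N, (L * texp ((1 - u) • L)).coord M * (φ M u - φ M 0)|
        ≤ w * (C * (Q * C₄ ^ α)) * B * ρ ^ γ := by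
    intro u hu
    have hmain : ‖∑ M ∈ words ℓ N, (L * texp ((1 - u) • L)).coord M * (φ M u - φ M 0)‖
        ≤ w * (C * (Q * C₄ ^ α) * B * ρ ^ γ) := by
      refine norm_sum_words_le le_rfl (by positivity) fun M hM => ?_
      rw [mem_words] at hM
      have h1 := (hEb (1 - u) (by linarith [hu.2]) (by linarith [hu.1])).2 M hM.le
      rw [hM] at h1
      have hg : HolderBound 0 α (Q * B) (wordDerivMap W M f) :=
        holderBound_wordDerivMap hB hK hW M (by omega) (hf.of_le (by omega))
      have h2 := hg.norm_sub_le (y u) (y 0)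
      have h3 : ‖y u - y 0‖ ^ α ≤ C₄ ^ α * ρ ^ α := by
        rw [← Real.mul_rpow hC40 hρ]
        exact Real.rpow_le_rpow (norm_nonneg _) (hmove u hu) hα
      rw [norm_mul, Real.norm_eq_abs]
      calc _ ≤ (C * ρ ^ N) * (Q * B * (C₄ ^ α * ρ ^ α)) := by
            refine mul_le_mul h1 (h2.trans ?_) (norm_nonneg _) (by positivity)
            gcongr
        _ = C * (Q * C₄ ^ α) * B * (ρ ^ N * ρ ^ α) := by ring
        _ = _ := by rw [hpowα]
    rw [Real.norm_eq_abs] at hmain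
    refine hmain.trans (le_of_eq ?_)
    ring
  -- On a nonempty word the coordinate of the exponential brings a factor `ρ`, so the whole drift
  -- term is `O(h ρ)` and need not be compensated.
  have hT2 : ∀ u ∈ Set.Icc (0 : ℝ) 1, ∀ m ∈ Finset.range n,
      |∑ M ∈ words ℓ (m + 1), (texp ((1 - u) • L)).coord M * r M u|
        ≤ w * (C * (Q * K + C₅)) * B * ρ ^ γ := by
    intro u hu m hm
    rw [Finset.mem_range] at hm
    have hmain : ‖∑ M ∈ words ℓ (m + 1), (texp ((1 - u) • L)).coord M * r M u‖
        ≤ w * (C * (Q * K + C₅) * B * ρ ^ γ) := by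
      refine norm_sum_words_le (by omega) (by positivity) fun M hM => ?_
      rw [mem_words] at hM
      have h1 := (hEb (1 - u) (by linarith [hu.2]) (by linarith [hu.1])).1 M (by omega)
      have h2 := hrb M (by omega) u
      have hg : HolderBound (N - M.length) α (Q * B) (wordDerivMap W M f) :=
        holderBound_wordDerivMap hB hK hW M (by omega) (hf.of_le (by omega))
      have h3 : |h * fderiv ℝ (wordDerivMap W M f) (y u) (V (y u))| ≤ h * (Q * B * K) := by
        rw [abs_mul, abs_of_nonneg hh0, ← Real.norm_eq_abs]
        gcongr
        exact (ContinuousLinearMap.le_opNorm _ _).trans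
          (mul_le_mul (hg.norm_fderiv_le (by omega) _) (hV _) (norm_nonneg _) (by positivity))
      have h4 : |r M u| ≤ h * (Q * B * K) + C₅ * B * ρ ^ (N + 1 - M.length) := by
        have := abs_add_le (r M u - h * fderiv ℝ (wordDerivMap W M f) (y u) (V (y u)))
          (h * fderiv ℝ (wordDerivMap W M f) (y u) (V (y u)))
        rw [sub_add_cancel] at this
        linarith
      have h5 : ρ ^ M.length * h ≤ ρ ^ γ := by
        refine le_trans ?_ hpowh
        rw [mul_comm h]
        gcongr
        exact pow_le_of_le_one hρ hρ1 (by omega)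
      have h6 : ρ ^ M.length * ρ ^ (N + 1 - M.length) ≤ ρ ^ γ := by
        rw [← pow_add, Nat.add_sub_cancel' (by omega)]
        exact hpowN
      rw [norm_mul, Real.norm_eq_abs, Real.norm_eq_abs]
      calc _ ≤ (C * ρ ^ M.length) * (h * (Q * B * K) + C₅ * B * ρ ^ (N + 1 - M.length)) :=
            mul_le_mul h1 h4 (abs_nonneg _) (by positivity)
        _ = C * B * (Q * K * (ρ ^ M.length * h)
              + C₅ * (ρ ^ M.length * ρ ^ (N + 1 - M.length))) := by ring
        _ ≤ C * B * (Q * K * ρ ^ γ + C₅ * ρ ^ γ) := by gcongr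
        _ = _ := by ring
    rw [Real.norm_eq_abs] at hmain
    refine hmain.trans (le_of_eq ?_)
    ring
  -- On the empty word the coefficient is `1`, so the drift at time `0` must be subtracted. What
  -- remains is `h` times an increment of `V f`, of order `h ρ` since `V` and `Df` are bounded and
  -- Lipschitz (`N ≥ 2`).
  have hT3 : ∀ u ∈ Set.Icc (0 : ℝ) 1,
      |r [] u - h * fderiv ℝ f (y 0) (V (y 0))| ≤ (C₅ + 2 * K * C₄) * B * ρ ^ γ := by
    intro u hu
    have h1 := hrb [] (by rw [List.length_nil]; omega) u
    rw [List.length_nil, Nat.sub_zero] at h1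
    have hDf : HolderBound n α B (fderiv ℝ f) := (hf.of_le hNn.ge).fderiv
    have h2 : ‖fderiv ℝ f (y u) - fderiv ℝ f (y 0)‖ ≤ B * ‖y u - y 0‖ :=
      Convex.norm_image_sub_le_of_norm_fderiv_le (𝕜 := ℝ) (s := Set.univ)
        (fun z _ => (hDf.of_le hn).contDiff.differentiable (by norm_num) z)
        (fun z _ => hDf.norm_fderiv_le hn z) convex_univ trivial trivial
    have h3 : |fderiv ℝ f (y u) (V (y u)) - fderiv ℝ f (y 0) (V (y 0))|
        ≤ 2 * K * B * (C₄ * ρ) := by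
      have h4 : fderiv ℝ f (y u) (V (y u)) - fderiv ℝ f (y 0) (V (y 0))
          = (fderiv ℝ f (y u) - fderiv ℝ f (y 0)) (V (y u))
            + fderiv ℝ f (y 0) (V (y u) - V (y 0)) := by
        simp
      have h5 : ‖(fderiv ℝ f (y u) - fderiv ℝ f (y 0)) (V (y u))‖ ≤ B * ‖y u - y 0‖ * K :=
        (ContinuousLinearMap.le_opNorm _ _).trans
          (mul_le_mul h2 (hV _) (norm_nonneg _) (by positivity))
      have h6 : ‖fderiv ℝ f (y 0) (V (y u) - V (y 0))‖ ≤ B * (K * ‖y u - y 0‖) :=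
        (ContinuousLinearMap.le_opNorm _ _).trans
          (mul_le_mul (hf.norm_fderiv_le (by omega) _) (hVl _ _) (norm_nonneg _) hB)
      rw [h4, ← Real.norm_eq_abs]
      refine (norm_add_le _ _).trans ((add_le_add h5 h6).trans ?_)
      calc _ = 2 * K * B * ‖y u - y 0‖ := by ring
        _ ≤ _ := by
          have := hmove u hu
          gcongr
    have h7 : |h * fderiv ℝ f (y u) (V (y u)) - h * fderiv ℝ f (y 0) (V (y 0))|
        ≤ 2 * K * C₄ * B * ρ ^ γ := by
      rw [← mul_sub, abs_mul, abs_of_nonneg hh0]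
      calc _ ≤ h * (2 * K * B * (C₄ * ρ)) := by gcongr
        _ = 2 * K * C₄ * B * (h * ρ) := by ring
        _ ≤ _ := by gcongr
    have h8 : C₅ * B * ρ ^ (N + 1) ≤ C₅ * B * ρ ^ γ := by gcongr
    have h9 := abs_sub_le (r [] u) (h * fderiv ℝ f (y u) (V (y u)))
      (h * fderiv ℝ f (y 0) (V (y 0)))
    have h10 : |r [] u - h * fderiv ℝ f (y u) (V (y u))| ≤ C₅ * B * ρ ^ (N + 1) := h1
    linarith
  refine abs_sub_sum_coord_texp_le (by omega) hL0 hφd fun u hu => ?_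
  have hu' : u ∈ Set.Icc (0 : ℝ) 1 := ⟨hu.1, hu.2.le⟩
  have hE0 : (texp ((1 - u) • L)).coord [] = 1 :=
    coord_texp_nil (by rw [coord_smul, hL0, mul_zero])
  have hsum : ∑ m ∈ Finset.range N, ∑ M ∈ words ℓ m, (texp ((1 - u) • L)).coord M * r M u
      = ∑ m ∈ Finset.range n, ∑ M ∈ words ℓ (m + 1), (texp ((1 - u) • L)).coord M * r M u
        + r [] u := by
    rw [show Finset.range N = Finset.range (n + 1) by rw [hNn], Finset.sum_range_succ',
      sum_words_zero, hE0, one_mul]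
  have hT2' : |∑ m ∈ Finset.range n, ∑ M ∈ words ℓ (m + 1), (texp ((1 - u) • L)).coord M * r M u|
      ≤ n * (w * (C * (Q * K + C₅)) * B * ρ ^ γ) := by
    refine (Finset.abs_sum_le_sum_abs _ _).trans ((Finset.sum_le_sum (hT2 u hu')).trans ?_)
    rw [Finset.sum_const, Finset.card_range, nsmul_eq_mul]
  rw [hsum]
  have h1 := hT1 u hu'
  have h3 := hT3 u hu'
  rw [abs_le] at h1 hT2' h3 ⊢
  constructor <;> linarith [h1.1, h1.2, hT2'.1, hT2'.2, h3.1, h3.2]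

end LocalError

/-! ### Existence of solutions of the log-ODE -/

section Existence

open scoped Pointwise

variable {E : Type*} [NormedAddCommGroup E] [NormedSpace ℝ E] {ℓ N : ℕ}

theorem IsCompactOnBalls.add {G H : E → E} (hG : IsCompactOnBalls G) (hH : IsCompactOnBalls H) :
    IsCompactOnBalls fun x => G x + H x := by
  intro y₀ R
  obtain ⟨C, hC, hGC⟩ := hG y₀ R
  obtain ⟨D, hD, hHD⟩ := hH y₀ R
  exact ⟨C + D, hC.add hD, fun x hx => Set.add_mem_add (hGC hx) (hHD hx)⟩

theorem IsCompactOnBalls.const_smul {G : E → E} (hG : IsCompactOnBalls G) (c : ℝ) :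
    IsCompactOnBalls fun x => c • G x := by
  intro y₀ R
  obtain ⟨C, hC, hGC⟩ := hG y₀ R
  exact ⟨c • C, hC.smul c, fun x hx => Set.smul_mem_smul_set (hGC hx)⟩

theorem isCompactOnBalls_sum {ι : Type*} (s : Finset ι) {G : ι → E → E}
    (hG : ∀ i ∈ s, IsCompactOnBalls (G i)) : IsCompactOnBalls fun x => ∑ i ∈ s, G i x := by
  classical
  induction s using Finset.induction_on with
  | empty => exact fun _ _ => ⟨{0}, isCompact_singleton, fun x _ => by simp⟩
  | insert a s ha ih =>
    simp only [Finset.sum_insert ha]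
    exact (hG a (Finset.mem_insert_self a s)).add
      (ih fun i hi => hG i (Finset.mem_insert_of_mem hi))

theorem exists_homBound_one (a : TruncTensor ℓ N) : ∃ C : ℝ, 0 ≤ C ∧ HomBound N C 1 a := by
  refine ⟨∑ k ∈ Finset.range (N + 1), ∑ w ∈ words ℓ k, |a.coord w|,
    Finset.sum_nonneg fun _ _ => Finset.sum_nonneg fun _ _ => abs_nonneg _, fun w hw => ?_⟩
  rw [one_pow, mul_one]
  refine le_trans ?_ (Finset.single_le_sum
    (f := fun k => ∑ w ∈ words ℓ k, |a.coord w|)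
    (fun _ _ => Finset.sum_nonneg fun _ _ => abs_nonneg _)
    (Finset.mem_range.2 (Nat.lt_succ_iff.2 hw)))
  exact Finset.single_le_sum (f := fun w => |a.coord w|) (fun _ _ => abs_nonneg _)
    (mem_words.2 rfl)

/-- The drift is the Lipschitz part and the brackets form the compact part. Only finiteness of the
bounds matters here, so the homogeneous estimates are used with `ρ = 1`. -/
theorem exists_logODE_solution [CompleteSpace E] {V : E → E} {W : Fin ℓ → E → E} {n : ℕ}
    {α K' : ℝ} {K : ℝ≥0} (hNn : N ≤ n + 1) (hV : ∀ x, ‖V x‖ ≤ K) (hVl : LipschitzWith K V)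
    (hK' : 0 ≤ K') (hW : ∀ i, HolderBound n α K' (W i)) (hWc : MapsBallsIntoCompacts N W)
    (h : ℝ) (Λ : List (Fin ℓ) → ℝ) (x : E) :
    ∃ y : ℝ → E, y 0 = x ∧ ∀ u ∈ Set.Icc (0 : ℝ) 1,
      HasDerivWithinAt y (logODEField N V W h Λ (y u)) (Set.Icc 0 1) u := by
  obtain ⟨C, hC, hΛ⟩ := exists_homBound_one (lieElement N Λ)
  have hQ := one_le_wordConst (n := n) hK'
  have hw := wordCount_nonneg (ℓ := ℓ) (N := N)
  set D : ℝ := ∑ k ∈ Finset.Icc 1 N, wordCount ℓ N * (C * (wordConst n K' * K')) * 1 ^ k with hD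
  have hD0 : 0 ≤ D := Finset.sum_nonneg fun _ _ => by positivity
  have hA : LipschitzWith (‖h‖₊ * K) fun x => h • V x := (lipschitzWith_smul h).comp hVl
  have hfield : logODEField N V W h Λ
      = fun x => h • V x + ∑ k ∈ Finset.Icc 1 N, levelField W Λ k x :=
    funext fun x => logODEField_eq V W h Λ x
  simp only [hfield]
  refine exists_hasDerivWithinAt_of_lipschitz_add_compact
    (G := fun x => ∑ k ∈ Finset.Icc 1 N, levelField W Λ k x) (M := ‖h‖ * K + D)
    hA (fun x => ?_) ?_ (fun x => ?_) ?_ x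
  · rw [norm_smul]
    have := mul_le_mul_of_nonneg_left (hV x) (norm_nonneg h)
    linarith
  · refine continuous_finsetSum _ fun k hk => ?_
    refine continuous_finsetSum _ fun I hI => Continuous.const_smul ?_ _
    rw [Finset.mem_Icc] at hk
    rw [mem_words] at hI
    exact (contDiff_bracketField (m := 0) (fun i => (hW i).contDiff) I (by omega)).continuous
  · have h1 : ‖∑ k ∈ Finset.Icc 1 N, levelField W Λ k x‖ ≤ D := norm_sum_le_of_le _ fun k hk => by
      rw [Finset.mem_Icc] at hk
      exact norm_levelField_le hK' hC zero_le_one hW hΛ hk.1 hk.2 (by omega) x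
    have : 0 ≤ ‖h‖ * K := by positivity
    linarith
  · refine isCompactOnBalls_sum _ fun k hk => isCompactOnBalls_sum _ fun I hI => ?_
    rw [Finset.mem_Icc] at hk
    rw [mem_words] at hI
    exact IsCompactOnBalls.const_smul (hWc I (by omega) (by omega)) _

end Existence

/-! ### Bounds for rough paths -/

section RoughBounds

variable {ℓ N : ℕ}

theorem abs_coord_le_levelNorm (a : TruncTensor ℓ N) (w : List (Fin ℓ)) :
    |a.coord w| ≤ levelNorm w.length a := by
  rw [levelNorm, sum_ofFn_eq_sum_words w.length fun v => a.coord v ^ 2]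
  refine Real.abs_le_sqrt ?_
  exact Finset.single_le_sum (f := fun v => a.coord v ^ 2) (fun _ _ => sq_nonneg _)
    (mem_words.2 rfl)

theorem roughIncrement_self {X : ℝ → TruncTensor ℓ N} {s : ℝ} (hX : (X s).coord [] = 1) :
    roughIncrement X s s = 1 :=
  Ring.inverse_mul_cancel _ (isUnit_of_coord_nil hX)

theorem roughNorm_nonneg (p T : ℝ) (X : ℝ → TruncTensor ℓ ⌊p⌋₊) : 0 ≤ roughNorm p T X := by
  refine Real.sSup_nonneg ?_
  rintro _ ⟨i, s, t, -, -, -, -, -, rfl⟩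
  exact div_nonneg (Real.sqrt_nonneg _) (by positivity)

/-- The increments of a rough path have homogeneous bounds with respect to
`(1 + ‖𝐗‖) (t - s)^{1/p}`. -/
theorem homBound_roughIncrement {p T : ℝ} {X : ℝ → TruncTensor ℓ ⌊p⌋₊}
    (hX : IsWeakGeometricRoughPath p T X) {s t : ℝ} (hs : 0 ≤ s) (hst : s ≤ t) (htT : t ≤ T) :
    HomBound ⌊p⌋₊ 1 ((1 + roughNorm p T X) * (t - s) ^ (1 / p)) (roughIncrement X s t) := by
  have hR := roughNorm_nonneg p T X
  have hh : 0 ≤ t - s := by linarith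
  rcases hst.eq_or_lt with rfl | hlt
  · rw [roughIncrement_self (hX.scalar_part s hs htT)]
    exact HomBound.one (by positivity)
  intro w hw
  rcases eq_or_ne w [] with rfl | hne
  · obtain ⟨b, hb, hbe⟩ := hX.geometric s t hs hst htT
    obtain ⟨Λ, rfl⟩ := exists_lieElement_eq hb
    rw [← hbe, coord_texp_nil (coord_lieElement_nil Λ)]
    simp
  have hpos : 0 < t - s := by linarith
  have h1 : 1 ≤ w.length := List.length_pos_iff.2 hne
  have h2 : levelNorm w.length (roughIncrement X s t) / |t - s| ^ ((w.length : ℝ) / p)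
      ≤ roughNorm p T X :=
    le_csSup hX.holder ⟨w.length, s, t, h1, hw, hs, hlt, htT, rfl⟩
  rw [abs_of_pos hpos, div_le_iff₀ (by positivity)] at h2
  have h3 : (t - s) ^ ((w.length : ℝ) / p) = ((t - s) ^ (1 / p)) ^ w.length := by
    rw [← Real.rpow_natCast, ← Real.rpow_mul hh]
    congr 1
    ring
  -- The rough norm enters each level to the first power, while a homogeneous bound carries the
  -- power `|w|`; replacing it by `1 + ‖𝐗‖ ≥ 1` reconciles the two.
  have h4 : roughNorm p T X ≤ (1 + roughNorm p T X) ^ w.length := by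
    calc roughNorm p T X ≤ 1 + roughNorm p T X := by linarith
      _ = (1 + roughNorm p T X) ^ 1 := (pow_one _).symm
      _ ≤ _ := pow_le_pow_right₀ (by linarith) h1
  rw [one_mul, mul_pow]
  rw [h3] at h2
  exact (abs_coord_le_levelNorm _ w).trans (h2.trans (by gcongr))

theorem one_add_rpow_le {x γ : ℝ} (hx : 0 ≤ x) (hγ : 0 ≤ γ) :
    (1 + x) ^ γ ≤ 2 ^ γ * (1 + x ^ γ) := by
  have hx' : 0 ≤ x ^ γ := by positivity
  rcases le_total x 1 with h | h
  · calc (1 + x) ^ γ ≤ 2 ^ γ := Real.rpow_le_rpow (by linarith) (by linarith) hγ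
      _ = 2 ^ γ * 1 := (mul_one _).symm
      _ ≤ _ := by gcongr; linarith
  · calc (1 + x) ^ γ ≤ (2 * x) ^ γ := Real.rpow_le_rpow (by linarith) (by linarith) hγ
      _ = 2 ^ γ * x ^ γ := Real.mul_rpow (by norm_num) hx
      _ ≤ _ := by gcongr; linarith

end RoughBounds

/-! ### Increments of arbitrary size and the main theorem -/

section MainEstimate

variable {E : Type*} [NormedAddCommGroup E] [NormedSpace ℝ E]

/-- The error estimate for increments of arbitrary size. -/
theorem exists_error_const (ℓ N : ℕ) {n : ℕ} (hNn : N = n + 1) (hn : 1 ≤ n) {K α p γ : ℝ}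
    (hK : 0 ≤ K) (hα : 0 ≤ α) (hp : 1 ≤ p) (hγ : γ = N + α) (hα1 : α ≤ 1) (hγp : γ ≤ p + 1)
    (hpγ : p ≤ γ) :
    ∃ c : ℝ, 0 ≤ c ∧ ∀ {V : E → E} {W : Fin ℓ → E → E} {Λ : List (Fin ℓ) → ℝ} {ρ h B : ℝ}
      {f : E → ℝ} {y : ℝ → E}, (∀ x, ‖V x‖ ≤ K) → (∀ x y, ‖V x - V y‖ ≤ K * ‖x - y‖) →
      (∀ i, HolderBound n α K (W i)) → 0 ≤ B → HolderBound N α B f → 0 ≤ ρ → 0 ≤ h →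
      h ≤ ρ ^ p → HomBound N 1 ρ (texp (lieElement N Λ)) →
      (∀ u ∈ Set.Icc (0 : ℝ) 1,
        HasDerivWithinAt y (logODEField N V W h Λ (y u)) (Set.Icc 0 1) u) →
      |f (y 1) - ∑ m ∈ Finset.range (N + 1), ∑ M ∈ words ℓ m,
          (texp (lieElement N Λ)).coord M * wordDerivMap W M f (y 0)
        - h * fderiv ℝ f (y 0) (V (y 0))| ≤ c * B * ρ ^ γ := by
  obtain ⟨c, hc0, hc⟩ := exists_taylor_const (E := E) ℓ N hNn hn hK hα hp hγ hα1 hγp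
  set Q := wordConst n K with hQdef
  have hQ1 : 1 ≤ Q := one_le_wordConst hK
  have hw0 : 0 ≤ wordCount ℓ N := wordCount_nonneg
  refine ⟨c + (1 + (N + 1) * (wordCount ℓ N * Q) + K), by positivity, ?_⟩
  intro V W Λ ρ h B f y hV hVl hW hB hf hρ hh0 hh hexp hy
  have hργ : 0 ≤ ρ ^ γ := by positivity
  rcases le_total ρ 1 with hρ1 | hρ1
  · refine (hc hV hVl hW hB hf hρ hρ1 hh0 hh hexp hy).trans ?_
    gcongr
    have : 0 ≤ 1 + (N + 1) * (wordCount ℓ N * Q) + K := by positivity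
    linarith
  -- For `ρ ≥ 1` no cancellation is needed: `|M| ≤ N ≤ γ` and `p ≤ γ` bound each term by a multiple
  -- of `B * ρ ^ γ`.
  have hone : 1 ≤ ρ ^ γ := Real.one_le_rpow hρ1 (by rw [hγ]; positivity)
  have h1 : |f (y 1)| ≤ B * ρ ^ γ :=
    (hf.norm_le (y 1)).trans (le_mul_of_one_le_right hB hone)
  have h2 : |∑ m ∈ Finset.range (N + 1), ∑ M ∈ words ℓ m,
      (texp (lieElement N Λ)).coord M * wordDerivMap W M f (y 0)|
      ≤ (N + 1) * (wordCount ℓ N * Q) * B * ρ ^ γ := by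
    have hm : ∀ m ∈ Finset.range (N + 1), ‖∑ M ∈ words ℓ m,
        (texp (lieElement N Λ)).coord M * wordDerivMap W M f (y 0)‖
        ≤ wordCount ℓ N * (Q * B * ρ ^ γ) := by
      intro m hm
      rw [Finset.mem_range] at hm
      refine norm_sum_words_le (by omega) (by positivity) fun M hM => ?_
      rw [mem_words] at hM
      have e1 := hexp M (by omega)
      have hg : HolderBound 0 α (Q * B) (wordDerivMap W M f) :=
        holderBound_wordDerivMap hB hK hW M (by omega) (hf.of_le (by omega))
      have e2 : ρ ^ M.length ≤ ρ ^ γ := by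
        rw [← Real.rpow_natCast]
        refine Real.rpow_le_rpow_of_exponent_le hρ1 ?_
        have : (M.length : ℝ) ≤ N := by exact_mod_cast (by omega)
        linarith
      rw [one_mul] at e1
      rw [norm_mul, Real.norm_eq_abs, mul_comm (Q * B)]
      exact mul_le_mul (e1.trans e2) (hg.norm_le _) (norm_nonneg _) hργ
    refine (norm_sum_le_of_le _ hm).trans (le_of_eq ?_)
    rw [Finset.sum_const, Finset.card_range, nsmul_eq_mul]
    push_cast
    ring
  have h3 : |h * fderiv ℝ f (y 0) (V (y 0))| ≤ K * B * ρ ^ γ := by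
    rw [abs_mul, abs_of_nonneg hh0, ← Real.norm_eq_abs]
    have e1 : ‖fderiv ℝ f (y 0) (V (y 0))‖ ≤ B * K :=
      (ContinuousLinearMap.le_opNorm _ _).trans
        (mul_le_mul (hf.norm_fderiv_le (by omega) _) (hV _) (norm_nonneg _) hB)
    have e2 : h ≤ ρ ^ γ := hh.trans (Real.rpow_le_rpow_of_exponent_le hρ1 hpγ)
    calc _ ≤ ρ ^ γ * (B * K) := mul_le_mul e2 e1 (norm_nonneg _) hργ
      _ = _ := by ring
  have h4 : 0 ≤ c * B * ρ ^ γ := by positivity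
  rw [abs_le] at h1 h2 h3 ⊢
  constructor <;> nlinarith [h1.1, h1.2, h2.1, h2.2, h3.1, h3.2]

end MainEstimate

theorem mainTheorem8 {E : Type*} [NormedAddCommGroup E] [NormedSpace ℝ E] [CompleteSpace E]
    (ℓ : ℕ) (p γ : ℝ) (hp : 2 ≤ p) (hpγ : p < γ) (hγ : γ < (⌊p⌋₊ : ℝ) + 1) (K : ℝ≥0) :
    ∃ c : ℝ, 0 < c ∧
      ∀ (V : E → E) (W : Fin ℓ → E → E),
        (∀ x, ‖V x‖ ≤ K) → LipschitzWith K V →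
        (∀ i, IsGammaLipschitz (γ - 1) (W i)) → (∀ i, gammaNorm (γ - 1) (W i) ≤ K) →
        MapsBallsIntoCompacts ⌊γ⌋₊ W →
      ∀ (T : ℝ), 0 < T → ∀ (X : ℝ → TruncTensor ℓ ⌊p⌋₊), IsWeakGeometricRoughPath p T X →
      ∀ (s t : ℝ), 0 ≤ s → s ≤ t → t ≤ T →
        (∃ m : E → E, IsLogODEMap V W X s t m) ∧
        ∀ m : E → E, IsLogODEMap V W X s t m →
          ∀ f : E → ℝ, IsGammaLipschitz γ f → ∀ x : E,
            |f (m x) - (f x + (t - s) * fieldDeriv V f x +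
                ∑ r ∈ Finset.Icc 1 ⌊p⌋₊, ∑ I : Fin r → Fin ℓ,
                  (roughIncrement X s t).coord (List.ofFn I) * wordDeriv W (List.ofFn I) f x)|
              ≤ c * (1 + roughNorm p T X ^ γ) * gammaNorm γ f * |t - s| ^ (γ / p) := by
  have hp0 : 0 < p := by linarith
  have hγ0 : 0 < γ := by linarith
  have hpfl : (⌊p⌋₊ : ℝ) ≤ p := Nat.floor_le hp0.le
  have hflγ : ⌊γ⌋₊ = ⌊p⌋₊ := (Nat.floor_eq_iff hγ0.le).2 ⟨by linarith, hγ⟩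
  have hN2 : 2 ≤ ⌊p⌋₊ := Nat.le_floor (by exact_mod_cast hp)
  obtain ⟨n, hNn⟩ : ∃ n, ⌊p⌋₊ = n + 1 := ⟨⌊p⌋₊ - 1, by omega⟩
  have hn : 1 ≤ n := by omega
  have hflγ1 : ⌊γ - 1⌋₊ = n := by rw [Nat.floor_sub_one, hflγ, hNn, Nat.add_sub_cancel]
  have hfr1 : Int.fract (γ - 1) = Int.fract γ := Int.fract_sub_one γ
  have hγα : γ = (⌊p⌋₊ : ℝ) + Int.fract γ := by
    rw [← hflγ, natCast_floor_eq_intCast_floor hγ0.le, Int.floor_add_fract]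
  have hα0 : 0 ≤ Int.fract γ := Int.fract_nonneg γ
  have hα1 : Int.fract γ ≤ 1 := (Int.fract_lt_one γ).le
  have hK2 : (0 : ℝ) ≤ 2 * K := by positivity
  obtain ⟨c, hc0, hc⟩ := exists_error_const (E := E) ℓ ⌊p⌋₊ hNn hn (K := 2 * K) (p := p) hK2 hα0
    (by linarith) hγα hα1 (by linarith) hpγ.le
  -- Adding `1` ensures positivity, the factor `2` comes from `IsGammaLipschitz.holderBound` for
  -- `f`, and `2 ^ γ` from comparing `(1 + ‖𝐗‖) ^ γ` with `1 + ‖𝐗‖ ^ γ`.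
  refine ⟨(c + 1) * 2 * 2 ^ γ, by positivity, ?_⟩
  intro V W hV hVl hW hWK hWc T hT X hX s t hs hst htT
  have hWb : ∀ i, HolderBound n (Int.fract γ) (2 * K) (W i) := by
    intro i
    have := (hW i).holderBound (hWK i)
    rwa [hflγ1, hfr1] at this
  refine ⟨?_, ?_⟩
  · obtain ⟨Λ, hΛ⟩ := exists_isLogCoordinates (hX.geometric s t hs hst htT)
    rw [hflγ] at hWc
    choose y hy0 hy using exists_logODE_solution (N := ⌊p⌋₊) hNn.le hV hVl hK2 hWb hWc (t - s) Λ
    exact ⟨fun x => y x 1, Λ, hΛ, fun x => ⟨y x, hy0 x, rfl, hy x⟩⟩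
  · rintro m ⟨Λ, hΛ, hm⟩ f hf x
    obtain ⟨y, hy0, hy1, hy⟩ := hm x
    rw [isLogCoordinates_iff] at hΛ
    have hR := roughNorm_nonneg p T X
    have hh : 0 ≤ t - s := by linarith
    have hexp := homBound_roughIncrement hX hs hst htT
    have hfb := hf.holderBound le_rfl
    rw [hflγ] at hfb
    have hG0 : 0 ≤ gammaNorm γ f := ENNReal.toReal_nonneg
    -- The scale `ρ` that governs the increments also governs the drift, again because `1 + ‖𝐗‖ ≥
    -- 1`.
    have hρp : t - s ≤ ((1 + roughNorm p T X) * (t - s) ^ (1 / p)) ^ p := by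
      rw [Real.mul_rpow (by positivity) (by positivity), ← Real.rpow_mul hh,
        one_div_mul_cancel hp0.ne', Real.rpow_one]
      exact le_mul_of_one_le_left hh (Real.one_le_rpow (by linarith) hp0.le)
    have hργ : ((1 + roughNorm p T X) * (t - s) ^ (1 / p)) ^ γ
        ≤ 2 ^ γ * (1 + roughNorm p T X ^ γ) * |t - s| ^ (γ / p) := by
      rw [Real.mul_rpow (by positivity) (by positivity), ← Real.rpow_mul hh, abs_of_nonneg hh,
        one_div_mul_eq_div]
      have := one_add_rpow_le hR hγ0.le
      gcongr
    rw [← hΛ] at hexp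
    have key := hc (V := V) (fun x => (hV x).trans (by linarith [K.2]))
      (fun x y => (hVl.norm_sub_le x y).trans (by gcongr; linarith [K.2]))
      hWb (by positivity) hfb (by positivity) hh hρp hexp hy
    rw [hy0, hy1, hΛ] at key
    have hsum : ∑ k ∈ Finset.range (⌊p⌋₊ + 1), ∑ M ∈ words ℓ k,
        (roughIncrement X s t).coord M * wordDerivMap W M f x
        = f x + ∑ r ∈ Finset.Icc 1 ⌊p⌋₊, ∑ I : Fin r → Fin ℓ,
          (roughIncrement X s t).coord (List.ofFn I) * wordDeriv W (List.ofFn I) f x := by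
      have hins : Finset.range (⌊p⌋₊ + 1) = insert 0 (Finset.Icc 1 ⌊p⌋₊) := by
        ext k
        simp only [Finset.mem_range, Finset.mem_insert, Finset.mem_Icc]
        omega
      rw [hins, Finset.sum_insert (by simp), sum_words_zero]
      congr 1
      · rw [← hΛ, coord_texp_nil (coord_lieElement_nil Λ), one_mul]
        rfl
      · refine Finset.sum_congr rfl fun r _ => ?_
        simp only [wordDeriv_eq_wordDerivMap]
        exact (sum_ofFn_eq_sum_words r fun M =>
          (roughIncrement X s t).coord M * wordDerivMap W M f x).symm
    rw [hsum] at key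
    have hconv : ∀ a b d e : ℝ, a - (b + d + e) = a - (b + e) - d := fun a b d e => by ring
    rw [hconv]
    refine key.trans ?_
    calc c * (2 * gammaNorm γ f) * ((1 + roughNorm p T X) * (t - s) ^ (1 / p)) ^ γ
        ≤ (c + 1) * (2 * gammaNorm γ f)
          * (2 ^ γ * (1 + roughNorm p T X ^ γ) * |t - s| ^ (γ / p)) := by
          gcongr
          linarith
      _ = _ := by ring
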